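/- For real $\nu\ge 0$ let $J_\nu$ denote the Bessel function of the first kind. For integers $d\ge 2$, $k\ge 0$ and $2d/(d-1)<q<\infty$ let $$\Lambda_{d,q}(k)=\left(\int_0^\infty\big|r^{-\frac d2+1}J_{\frac d2-1+k}(r)\big|^q\,r^{d-1}\,dr\right)^{1/q},\qquad \Lambda_{d,\infty}(k)=\sup_{r\ge 0}\big|r^{-\frac d2+1}J_{\frac d2-1+k}(r)\big|,$$ where the value at $r=0$ in the second formula is the limit as $r\to 0^+$. Let $$\mathbf L:=\sup_{\nu>0,\;r>0}\big|r^{1/3}J_\nu(r)\big| ,$$ a finite number, $\mathbf L=0.785746\ldots$ (that is, $0.785746\le\mathbf L<0.785747$). Let $d\ge 2$ be an integer and $2d/(d-\frac43)<q\le\infty$. Then for every integer $k\ge 0$ one has $\Lambda_{d,q}(k)\le U_{d,q}(k)$, where for $q<\infty$ $$U_{d,q}(k)=\mathbf L^{\frac{k+\frac dq}{\frac d2+k-\frac23}}\;2^{\frac{(\frac d2+k-1)(-\frac d2+\frac23+\frac dq)}{\frac d2+k-\frac23}}\;\Gamma\big(\tfrac d2+k\big)^{\frac{-\frac d2+\frac23+\frac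 dq}{\frac d2+k-\frac23}}\left(\frac1{kq+d}+\frac1{q(\frac d2-\frac23)-d}\right)^{1/q},$$ and, for $q=\infty$, $$U_{d,\infty}(k)=\mathbf L^{\frac{k}{\frac d2+k-\frac23}}\;2^{\frac{(\frac d2+k-1)(-\frac d2+\frac23)}{\frac d2+k-\frac23}}\;\Gamma\big(\tfrac d2+k\big)^{\frac{-\frac d2+\frac23}{\frac d2+k-\frac23}}.$$ Moreover, for fixed $d$ and $q$, $U_{d,q}(k)$ is a strictly decreasing function of $k\in\{0,1,2,\dots\}$. -/

import Mathlib

open MeasureTheory Set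
open scoped ENNReal

noncomputable section

/-- The Bessel function of the first kind of real order `ν`, at `r > 0`:
`J_ν(r) = ∑ₙ (-1)ⁿ / (n! Γ(ν + n + 1)) (r/2)^(2n+ν)`. -/
def besselJ (ν r : ℝ) : ℝ :=
  (r / 2) ^ ν *
    ∑' n : ℕ, (-1 : ℝ) ^ n / ((n.factorial : ℝ) * Real.Gamma (ν + n + 1)) * (r / 2) ^ (2 * n)

/-- The set of all values `|r^{1/3} J_ν(r)|` with `ν > 0` and `r > 0`. -/
def landauSet : Set ℝ :=
  {y | ∃ ν r : ℝ, 0 < ν ∧ 0 < r ∧ y = |r ^ (1 / 3 : ℝ) * besselJ ν r|}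

/-- Landau's constant `L = sup_{ν > 0, r > 0} |r^{1/3} J_ν(r)|`. -/
def landauL : ℝ := sSup landauSet

/-- The weighted norm `Λ_{d,q}(k)` of a Bessel function, with values in `[0, ∞]`. For `q = ∞` it is
the supremum over `r > 0`, which is the same as the supremum over `r ≥ 0` of the continuous
extension of `r ↦ r^{1-d/2} J_{d/2-1+k}(r)` to `r = 0`. -/
def besselNorm (d : ℕ) (q : ℝ≥0∞) (k : ℕ) : ℝ≥0∞ :=
  if q = ∞ then
    ⨆ r ∈ Ioi (0 : ℝ),
      ENNReal.ofReal |r ^ (-(d : ℝ) / 2 + 1) * besselJ ((d : ℝ) / 2 - 1 + k) r|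
  else
    (∫⁻ r in Ioi (0 : ℝ),
      ENNReal.ofReal (|r ^ (-(d : ℝ) / 2 + 1) * besselJ ((d : ℝ) / 2 - 1 + k) r| ^ q.toReal
        * r ^ ((d : ℝ) - 1))) ^ (1 / q.toReal)

/-- The bound `U_{d,q}(k)` for a real exponent `q`. -/
def besselBoundReal (d : ℕ) (q : ℝ) (k : ℕ) : ℝ :=
  landauL ^ (((k : ℝ) + d / q) / ((d : ℝ) / 2 + k - 2 / 3))
    * (2 : ℝ) ^ ((((d : ℝ) / 2 + k - 1) * (-(d : ℝ) / 2 + 2 / 3 + d / q))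
        / ((d : ℝ) / 2 + k - 2 / 3))
    * Real.Gamma ((d : ℝ) / 2 + k) ^ ((-(d : ℝ) / 2 + 2 / 3 + d / q) / ((d : ℝ) / 2 + k - 2 / 3))
    * (1 / ((k : ℝ) * q + d) + 1 / (q * ((d : ℝ) / 2 - 2 / 3) - d)) ^ (1 / q)

/-- The bound `U_{d,∞}(k)`: the limit of `U_{d,q}(k)` as `q → ∞`. -/
def besselBoundTop (d k : ℕ) : ℝ :=
  landauL ^ ((k : ℝ) / ((d : ℝ) / 2 + k - 2 / 3))
    * (2 : ℝ) ^ ((((d : ℝ) / 2 + k - 1) * (-(d : ℝ) / 2 + 2 / 3)) / ((d : ℝ) / 2 + k - 2 / 3))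
    * Real.Gamma ((d : ℝ) / 2 + k) ^ ((-(d : ℝ) / 2 + 2 / 3) / ((d : ℝ) / 2 + k - 2 / 3))

/-- The bound `U_{d,q}(k)`, for `q` up to and including `∞`. -/
def besselBound (d : ℕ) (q : ℝ≥0∞) (k : ℕ) : ℝ :=
  if q = ∞ then besselBoundTop d k else besselBoundReal d q.toReal k

end

/-!
The proof has two independent halves: the numerical value of Landau's constant `L`, and the norm
bound, which uses only `0 < L < 1` and `|J_ν(r)| ≤ min ((r/2)^ν / Γ(ν+1), L r^{-1/3})`.

**Landau's constant.** It has to be shown that `x^{1/3} |J_ν(x)| ≤ 0.78574695` for all `ν, x > 0`.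
The supremum is attained in the limit `ν → 0`, at the maximum of `x^{1/3} J_0(x)`, and for larger
orders there is room to spare.

* *Amplitude.* Poisson's integral, moved to a vertical half-line by Cauchy's theorem, and Watson's
  lemma give `x (J_ν² + J_ν'²) → 2/π` (`tendsto_besselJ_sq_add_besselEuler`). After a Liouville
  transformation Bessel's equation becomes `z'' + (1 + r) z = 0` with `r` decreasing to `0`, so
  `z² + z'²/(1 + r)` increases to this limit. This yields the sharp bounds `x J_ν² ≤ 2/π` for
  `ν ≤ 1/2` (`mul_besselJ_sq_le`) and `√(x² - ν²) J_ν² ≤ 2/π` for `x > ν`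
  (`sqrt_mul_besselJ_sq_le`). They suffice when `x² - ν² ≥ 1.0312² x^{4/3}`, or `x ≥ 1.0312³` in the
  first case.
* *Monotonicity.* For `ν ≥ 1/2`, `x^{1/3} J_ν(x)` is increasing up to a point `b` from where on the
  amplitude bound is good enough, so the bound at `b` covers the smaller arguments. Lower bounds
  for `x J_ν'/J_ν` come from an integral identity for `(x J_ν')² - (ν² - x² ν/(ν+1)) J_ν²`
  (`lt_besselEuler_sq`), together with the recurrence in the order for `ν ≤ 8`
  (`besselJ_pos_and_increasing`), and with a subsolution of the Riccati equation beyond the turning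
  point for `ν ≥ 8` (`besselJ_pos_of_riccati`).
* *Small orders.* For `x ≤ 1.0312³` the alternating power series is compared with that of `J_0`.
  The factor `(x/2)^ν / Γ(ν+2) ≤ exp (-(1 - γ - log (x/2)) ν)` more than compensates what the order
  adds to the series (`abs_mul_besselJ_le_of_le`).

**Norm bound.** The two bounds for `J_ν`, `ν = d/2 - 1 + k`, agree at the radius `R` with
`R^{ν+1/3} = L 2^ν Γ(ν+1)`. Integrating the first over `(0, R)` and the second over `(R, ∞)` gives
exactly `U_{d,q}(k)`.

**Monotonicity in `k`.** Up to a factor that plainly decreases, `log U` is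
`log L - (d/2 - 2/3 - d/q) log R`, so `R` has to increase with `ν`. This amounts to
`log (L 2^ν Γ(ν+1)) < (ν + 1/3) log (2 (ν+1))`, which follows from `L < 1` and
`Γ(ν+1) ≤ (ν+1)^ν`, a case of log-convexity.
-/

open Filter Topology

/-! ### The Bessel series -/

/-- The entire function `z ↦ ∑ₙ (-1)ⁿ zⁿ / (n! Γ(ν + n + 1))`, so that
`J_ν(x) = (x/2)^ν * besselSeries ν (x²/4)`. -/
noncomputable def besselSeries (ν z : ℝ) : ℝ :=
  ∑' n : ℕ, (-1 : ℝ) ^ n / ((n.factorial : ℝ) * Real.Gamma (ν + n + 1)) * z ^ n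

lemma besselJ_eq (ν x : ℝ) : besselJ ν x = (x / 2) ^ ν * besselSeries ν (x ^ 2 / 4) := by
  unfold besselJ besselSeries
  congr 1
  refine tsum_congr fun n => ?_
  rw [show x ^ 2 / 4 = (x / 2) ^ 2 by ring, ← pow_mul]

lemma inv_Gamma_le {s : ℝ} (hs : 1 ≤ s) : (Real.Gamma s)⁻¹ ≤ s := by
  have h0 : 0 < Real.Gamma s := Real.Gamma_pos_of_pos (by linarith)
  have h1 : Real.Gamma (s + 1) = s * Real.Gamma s := Real.Gamma_add_one (by linarith)
  have h2 : 1 ≤ Real.Gamma (s + 1) := by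
    have := Real.Gamma_strictMonoOn_Ici.monotoneOn (a := 2) (b := s + 1)
      (by simp) (by simp; linarith) (by linarith)
    rwa [Real.Gamma_two] at this
  rw [inv_le_iff_one_le_mul₀ h0]
  linarith

/-- The comparison series for all convergence statements below. -/
lemma summable_mul_pow_div_factorial (C R : ℝ) :
    Summable fun n : ℕ => C * (R ^ n / (n.factorial : ℝ)) :=
  (Real.summable_pow_div_factorial R).mul_left C

lemma natCast_le_two_pow (n : ℕ) : (n : ℝ) ≤ 2 ^ n := by
  exact_mod_cast (Nat.lt_two_pow_self (n := n)).le

lemma abs_besselSeries_coeff_le {ν : ℝ} (hν : 0 ≤ ν) (n : ℕ) :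
    |(-1 : ℝ) ^ n / ((n.factorial : ℝ) * Real.Gamma (ν + n + 1))|
      ≤ (ν + 2) * (2 ^ n / (n.factorial : ℝ)) := by
  have hf : (0 : ℝ) < n.factorial := by exact_mod_cast n.factorial_pos
  have hn : (0 : ℝ) ≤ n := n.cast_nonneg
  have hG : 0 < Real.Gamma (ν + n + 1) := Real.Gamma_pos_of_pos (by linarith)
  rw [abs_div, abs_pow, abs_neg, abs_one, one_pow, abs_of_pos (mul_pos hf hG), one_div, mul_inv,
    ← mul_div_assoc, div_eq_mul_inv, mul_comm]
  refine mul_le_mul_of_nonneg_right ?_ (inv_nonneg.2 hf.le)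
  have h1 : (1 : ℝ) ≤ 2 ^ n := one_le_pow₀ (by norm_num)
  have h2 := natCast_le_two_pow n
  calc _ ≤ ν + n + 1 := inv_Gamma_le (by linarith)
    _ ≤ (ν + 2) * 2 ^ n := by nlinarith

lemma abs_besselSeries_term_le {ν : ℝ} (hν : 0 ≤ ν) {z R : ℝ} (hz : |z| ≤ R) (n : ℕ) :
    |(-1 : ℝ) ^ n / ((n.factorial : ℝ) * Real.Gamma (ν + n + 1)) * z ^ n|
      ≤ (ν + 2) * ((2 * R) ^ n / (n.factorial : ℝ)) := by
  rw [abs_mul, abs_pow, mul_pow, mul_div_right_comm, ← mul_assoc]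
  exact mul_le_mul (abs_besselSeries_coeff_le hν n) (pow_le_pow_left₀ (abs_nonneg _) hz n)
    (by positivity) (by positivity)

lemma summable_besselSeries {ν : ℝ} (hν : 0 ≤ ν) (z : ℝ) :
    Summable fun n : ℕ => (-1 : ℝ) ^ n / ((n.factorial : ℝ) * Real.Gamma (ν + n + 1)) * z ^ n :=
  Summable.of_norm_bounded (summable_mul_pow_div_factorial (ν + 2) (2 * |z|))
    fun n => abs_besselSeries_term_le hν le_rfl n

lemma hasDerivAt_besselSeries {ν : ℝ} (hν : 0 ≤ ν) (z : ℝ) :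
    HasDerivAt (besselSeries ν) (-besselSeries (ν + 1) z) z := by
  have key : HasDerivAt (besselSeries ν) (∑' n : ℕ,
      (-1 : ℝ) ^ n / ((n.factorial : ℝ) * Real.Gamma (ν + n + 1)) * (n * z ^ (n - 1))) z := by
    have hR : 1 ≤ |z| + 1 := by linarith [abs_nonneg z]
    refine hasDerivAt_tsum_of_isPreconnected (t := Ioo (-(|z| + 1)) (|z| + 1))
      (summable_mul_pow_div_factorial (ν + 2) (4 * (|z| + 1))) isOpen_Ioo
      isPreconnected_Ioo (fun n y _ => (hasDerivAt_pow n y).const_mul _) (fun n y hy => ?_)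
      (y₀ := z) (abs_lt.1 (by linarith)) (summable_besselSeries hν z) (abs_lt.1 (by linarith))
    have hy' : |y| ≤ |z| + 1 := (abs_lt.2 hy).le
    rw [Real.norm_eq_abs, abs_mul, abs_mul, Nat.abs_cast, abs_pow]
    have h3 : |y| ^ (n - 1) ≤ (|z| + 1) ^ n :=
      (pow_le_pow_left₀ (abs_nonneg _) hy' _).trans (pow_le_pow_right₀ hR (Nat.sub_le n 1))
    calc _ ≤ (ν + 2) * (2 ^ n / (n.factorial : ℝ)) * (2 ^ n * (|z| + 1) ^ n) :=
          mul_le_mul (abs_besselSeries_coeff_le hν n)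
            (mul_le_mul (natCast_le_two_pow n) h3 (by positivity) (by positivity))
            (by positivity) (by positivity)
      _ = (ν + 2) * ((4 * (|z| + 1)) ^ n / (n.factorial : ℝ)) := by
          rw [mul_pow, show (4 : ℝ) = 2 * 2 by norm_num, mul_pow]; ring
  convert key using 1
  have hs : Summable fun n : ℕ =>
      (-1 : ℝ) ^ n / ((n.factorial : ℝ) * Real.Gamma (ν + n + 1)) * (n * z ^ (n - 1)) := by
    rw [← summable_nat_add_iff 1]
    refine (summable_besselSeries (ν := ν + 1) (by linarith) z).neg.congr fun n => ?_
    have hf : (n.factorial : ℝ) ≠ 0 := by exact_mod_cast n.factorial_ne_zero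
    have hG : Real.Gamma (ν + 1 + n + 1) ≠ 0 := (Real.Gamma_pos_of_pos (by positivity)).ne'
    rw [Nat.factorial_succ, pow_succ, show ν + ((n + 1 : ℕ) : ℝ) + 1 = ν + 1 + n + 1 by
      push_cast; ring]
    push_cast
    field_simp
  rw [hs.tsum_eq_zero_add]
  simp only [CharP.cast_eq_zero, zero_mul, mul_zero, zero_add]
  unfold besselSeries
  rw [← tsum_neg]
  refine tsum_congr fun n => ?_
  have hf : (n.factorial : ℝ) ≠ 0 := by exact_mod_cast n.factorial_ne_zero
  have hG : Real.Gamma (ν + 1 + n + 1) ≠ 0 := (Real.Gamma_pos_of_pos (by positivity)).ne'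
  rw [Nat.factorial_succ, pow_succ, show ν + ((n + 1 : ℕ) : ℝ) + 1 = ν + 1 + n + 1 by
    push_cast; ring]
  push_cast
  field_simp

/-- The three-term recurrence in the order. -/
lemma besselSeries_recurrence {ν : ℝ} (hν : 0 ≤ ν) (z : ℝ) :
    besselSeries ν z = (ν + 1) * besselSeries (ν + 1) z - z * besselSeries (ν + 2) z := by
  have h1 := summable_besselSeries (ν := ν + 1) (by linarith) z
  have h2 := summable_besselSeries (ν := ν + 2) (by linarith) z
  have h0 := summable_besselSeries hν z
  have e : ∀ n : ℕ, (-1 : ℝ) ^ (n + 1) / (((n + 1).factorial : ℝ) *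
      Real.Gamma (ν + (n + 1 : ℕ) + 1)) * z ^ (n + 1) = (ν + 1) * ((-1 : ℝ) ^ (n + 1) /
      (((n + 1).factorial : ℝ) * Real.Gamma (ν + 1 + (n + 1 : ℕ) + 1)) * z ^ (n + 1)) -
      z * ((-1 : ℝ) ^ n / ((n.factorial : ℝ) * Real.Gamma (ν + 2 + n + 1)) * z ^ n) := by
    intro n
    have hf : (n.factorial : ℝ) ≠ 0 := by exact_mod_cast n.factorial_ne_zero
    have hG : Real.Gamma (ν + n + 2) ≠ 0 := (Real.Gamma_pos_of_pos (by positivity)).ne'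
    have hG' : Real.Gamma (ν + n + 3) = (ν + n + 2) * Real.Gamma (ν + n + 2) := by
      rw [← Real.Gamma_add_one (by positivity)]; ring_nf
    rw [Nat.factorial_succ, show ν + 1 + ((n + 1 : ℕ) : ℝ) + 1 = ν + n + 3 by push_cast; ring,
      show ν + ((n + 1 : ℕ) : ℝ) + 1 = ν + n + 2 by push_cast; ring,
      show ν + 2 + (n : ℝ) + 1 = ν + n + 3 by ring, hG']
    have : ν + n + 2 ≠ 0 := by positivity
    push_cast
    field_simp
    ring
  unfold besselSeries
  rw [h0.tsum_eq_zero_add, h1.tsum_eq_zero_add, mul_add, add_sub_assoc, ← tsum_mul_left,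
    ← tsum_mul_left, ← Summable.tsum_sub]
  · congr 1
    · have : Real.Gamma (ν + 1 + 1) = (ν + 1) * Real.Gamma (ν + 1) :=
        Real.Gamma_add_one (by positivity)
      have hG : Real.Gamma (ν + 1) ≠ 0 := (Real.Gamma_pos_of_pos (by positivity)).ne'
      have : ν + 1 ≠ 0 := by positivity
      simp only [CharP.cast_eq_zero, add_zero, pow_zero, Nat.factorial_zero, Nat.cast_one, one_mul,
        mul_one]
      rw [‹Real.Gamma (ν + 1 + 1) = _›]
      field_simp
    · exact tsum_congr e
  · exact ((summable_nat_add_iff 1).2 h1).mul_left _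
  · exact h2.mul_left _

lemma hasDerivAt_besselSeries_comp {ν : ℝ} (hν : 0 ≤ ν) (x : ℝ) :
    HasDerivAt (fun x : ℝ => besselSeries ν (x ^ 2 / 4))
      (-(x / 2 * besselSeries (ν + 1) (x ^ 2 / 4))) x := by
  have h := (hasDerivAt_besselSeries hν (x ^ 2 / 4)).comp x ((hasDerivAt_pow 2 x).div_const 4)
  refine h.congr_deriv ?_
  push_cast
  ring

/-- `J_{ν+1}` in terms of the series of order `ν + 1` and the power of order `ν`. -/
lemma besselJ_add_one_eq {ν x : ℝ} (hx : 0 < x) :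
    besselJ (ν + 1) x = (x / 2) ^ ν * (x / 2 * besselSeries (ν + 1) (x ^ 2 / 4)) := by
  rw [besselJ_eq, Real.rpow_add_one (by positivity)]
  ring

lemma hasDerivAt_besselJ {ν : ℝ} (hν : 0 ≤ ν) {x : ℝ} (hx : 0 < x) :
    HasDerivAt (besselJ ν) (ν / x * besselJ ν x - besselJ (ν + 1) x) x := by
  have hp : HasDerivAt (fun x : ℝ => (x / 2) ^ ν) (ν / x * (x / 2) ^ ν) x := by
    have := (((hasDerivAt_id x).div_const 2)).rpow_const (p := ν) (Or.inl (by simp; positivity))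
    refine this.congr_deriv ?_
    rw [id_eq, Real.rpow_sub_one (by positivity)]
    field_simp
  have h := hp.mul (hasDerivAt_besselSeries_comp hν x)
  have e : besselJ ν = (fun x : ℝ => (x / 2) ^ ν) * fun x => besselSeries ν (x ^ 2 / 4) := by
    funext y; exact besselJ_eq ν y
  rw [besselJ_add_one_eq hx, besselJ_eq, e]
  refine h.congr_deriv ?_
  ring

lemma besselJ_recurrence {ν : ℝ} (hν : 0 ≤ ν) {x : ℝ} (hx : 0 < x) :
    besselJ (ν + 2) x = 2 * (ν + 1) / x * besselJ (ν + 1) x - besselJ ν x := by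
  rw [show ν + 2 = ν + 1 + 1 by ring, besselJ_add_one_eq (ν := ν + 1) hx, besselJ_add_one_eq hx,
    besselJ_eq ν, besselSeries_recurrence hν, Real.rpow_add_one (by positivity),
    show ν + 1 + 1 = ν + 2 by ring]
  field_simp
  ring

lemma hasDerivAt_besselJ_add_one {ν : ℝ} (hν : 0 ≤ ν) {x : ℝ} (hx : 0 < x) :
    HasDerivAt (besselJ (ν + 1)) (besselJ ν x - (ν + 1) / x * besselJ (ν + 1) x) x := by
  have h := hasDerivAt_besselJ (ν := ν + 1) (by linarith) hx
  rw [show ν + 1 + 1 = ν + 2 by ring, besselJ_recurrence hν hx] at h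
  refine h.congr_deriv ?_
  field_simp
  ring

/-- The Euler derivative `x J_ν'(x)`, written without a derivative. -/
noncomputable def besselEuler (ν x : ℝ) : ℝ := ν * besselJ ν x - x * besselJ (ν + 1) x

lemma hasDerivAt_besselJ_euler {ν : ℝ} (hν : 0 ≤ ν) {x : ℝ} (hx : 0 < x) :
    HasDerivAt (besselJ ν) (besselEuler ν x / x) x := by
  convert hasDerivAt_besselJ hν hx using 1
  unfold besselEuler
  field_simp

/-- Bessel's equation, as a first-order equation for `x J_ν'(x)`. -/
lemma hasDerivAt_besselEuler {ν : ℝ} (hν : 0 ≤ ν) {x : ℝ} (hx : 0 < x) :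
    HasDerivAt (besselEuler ν) ((ν ^ 2 - x ^ 2) * besselJ ν x / x) x := by
  have h := ((hasDerivAt_besselJ hν hx).const_mul ν).sub
    ((hasDerivAt_id x).mul (hasDerivAt_besselJ_add_one hν hx))
  refine h.congr_deriv ?_
  rw [id_eq]
  field_simp
  ring

lemma besselSeries_zero (ν : ℝ) : besselSeries ν 0 = (Real.Gamma (ν + 1))⁻¹ := by
  unfold besselSeries
  rw [tsum_eq_single 0 (fun n hn => by simp [hn])]
  simp

/-- The pointwise bound `|J_ν(x)| ≤ (x/2)^ν / Γ(ν + 1)`. With `y = x^{-ν} J_ν`, Bessel's equation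
reads `y'' + (2ν + 1) y' / x + y = 0`, so that `y² + y'²` decreases. -/
lemma abs_besselSeries_le {ν : ℝ} (hν : 0 ≤ ν) {x : ℝ} (hx : 0 ≤ x) :
    |besselSeries ν (x ^ 2 / 4)| ≤ (Real.Gamma (ν + 1))⁻¹ := by
  set E : ℝ → ℝ := fun x => besselSeries ν (x ^ 2 / 4) ^ 2 +
    (x / 2 * besselSeries (ν + 1) (x ^ 2 / 4)) ^ 2 with hE
  have hd : ∀ x : ℝ, HasDerivAt E
      (-((2 * ν + 1) * x / 2 * besselSeries (ν + 1) (x ^ 2 / 4) ^ 2)) x := by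
    intro x
    have h := ((hasDerivAt_besselSeries_comp hν x).pow 2).add
      ((((hasDerivAt_id x).div_const 2).mul
        (hasDerivAt_besselSeries_comp (ν := ν + 1) (by linarith) x)).pow 2)
    refine h.congr_deriv ?_
    simp only [id_eq, besselSeries_recurrence hν (x ^ 2 / 4), show ν + 1 + 1 = ν + 2 by ring,
      Pi.mul_apply]
    push_cast
    ring
  have hanti : AntitoneOn E (Ici 0) := by
    refine antitoneOn_of_deriv_nonpos (convex_Ici 0)
      (fun y _ => (hd y).continuousAt.continuousWithinAt)
      (fun y _ => (hd y).differentiableAt.differentiableWithinAt) fun y hy => ?_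
    rw [interior_Ici] at hy
    rw [(hd y).deriv]
    have : (0 : ℝ) < y := hy
    have : 0 ≤ (2 * ν + 1) * y / 2 * besselSeries (ν + 1) (y ^ 2 / 4) ^ 2 := by positivity
    linarith
  have h := hanti (by simp : (0 : ℝ) ∈ Ici 0) hx hx
  have h0 : E 0 = (Real.Gamma (ν + 1))⁻¹ ^ 2 := by
    simp only [hE]; norm_num [besselSeries_zero]
  rw [h0] at h
  refine abs_le_of_sq_le_sq ?_ (inv_nonneg.2 (Real.Gamma_pos_of_pos (by positivity)).le)
  have : E x = besselSeries ν (x ^ 2 / 4) ^ 2 +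
    (x / 2 * besselSeries (ν + 1) (x ^ 2 / 4)) ^ 2 := rfl
  nlinarith [sq_nonneg (x / 2 * besselSeries (ν + 1) (x ^ 2 / 4))]

lemma abs_besselJ_le {ν : ℝ} (hν : 0 ≤ ν) {x : ℝ} (hx : 0 < x) :
    |besselJ ν x| ≤ (x / 2) ^ ν * (Real.Gamma (ν + 1))⁻¹ := by
  rw [besselJ_eq, abs_mul, abs_of_nonneg (Real.rpow_nonneg (by positivity) _)]
  exact mul_le_mul_of_nonneg_left (abs_besselSeries_le hν hx.le) (Real.rpow_nonneg (by positivity) _)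

/-- `J_ν(x) → J_0(x)` as `ν → 0⁺`. -/
lemma tendsto_besselJ_zero {x : ℝ} (hx : 0 < x) :
    Tendsto (fun ν => besselJ ν x) (𝓝[>] 0) (𝓝 (besselJ 0 x)) := by
  simp only [besselJ_eq]
  have h1 : Tendsto (fun ν : ℝ => (x / 2) ^ ν) (𝓝[>] 0) (𝓝 ((x / 2) ^ (0 : ℝ))) :=
    ((Real.continuous_const_rpow (by positivity : x / 2 ≠ 0)).tendsto 0).mono_left
      nhdsWithin_le_nhds
  refine h1.mul ?_
  unfold besselSeries
  refine tendsto_tsum_of_dominated_convergence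
    (summable_mul_pow_div_factorial 3 (2 * (x ^ 2 / 4))) (fun n => ?_) ?_
  · have hn : (0 : ℝ) < (0 : ℝ) + n + 1 := by positivity
    have hG : ContinuousAt (fun ν : ℝ => Real.Gamma (ν + n + 1)) 0 := by
      refine ContinuousAt.comp (g := Real.Gamma) ?_ (by fun_prop)
      exact (Real.differentiableAt_Gamma fun m => by
        have : (0 : ℝ) ≤ m := m.cast_nonneg
        linarith).continuousAt
    have hG0 := (Real.Gamma_pos_of_pos hn).ne'
    have hf : (n.factorial : ℝ) ≠ 0 := by exact_mod_cast n.factorial_ne_zero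
    exact (((continuousAt_const.div (continuousAt_const.mul hG) (mul_ne_zero hf hG0)).mul
      continuousAt_const).tendsto).mono_left nhdsWithin_le_nhds
  · filter_upwards [Ioo_mem_nhdsGT (zero_lt_one' ℝ)] with ν hν n
    rw [Real.norm_eq_abs]
    refine (abs_besselSeries_term_le hν.1.le (R := x ^ 2 / 4) (by
      rw [abs_of_nonneg (by positivity)]) n).trans ?_
    exact mul_le_mul_of_nonneg_right (by linarith [hν.2]) (by positivity)

/-- For `0 ≤ z ≤ 1` the terms of the series decrease in modulus, so that the partial sums bracket
its value. -/
lemma besselSeries_alternating {ν z : ℝ} (hν : 0 ≤ ν) (hz : 0 ≤ z) (hz1 : z ≤ 1) :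
    Antitone (fun n : ℕ => z ^ n / ((n.factorial : ℝ) * Real.Gamma (ν + n + 1))) ∧
    Tendsto (fun n => ∑ i ∈ Finset.range n, (-1) ^ i *
      (z ^ i / ((i.factorial : ℝ) * Real.Gamma (ν + i + 1)))) atTop (𝓝 (besselSeries ν z)) := by
  constructor
  · refine antitone_nat_of_succ_le fun n => ?_
    have hf : (0 : ℝ) < n.factorial := by exact_mod_cast n.factorial_pos
    have hn : (0 : ℝ) ≤ n := n.cast_nonneg
    have hG : 0 < Real.Gamma (ν + n + 1) := Real.Gamma_pos_of_pos (by positivity)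
    rw [Nat.factorial_succ, show ν + ((n + 1 : ℕ) : ℝ) + 1 = ν + n + 1 + 1 by push_cast; ring,
      Real.Gamma_add_one (by positivity), pow_succ, div_le_div_iff₀ (by positivity) (by positivity)]
    push_cast
    have h1 : z ≤ (n + 1) * (ν + n + 1) := by nlinarith
    have : 0 ≤ z ^ n * (n.factorial * Real.Gamma (ν + n + 1)) := by positivity
    nlinarith
  · refine (summable_besselSeries hν z).hasSum.tendsto_sum_nat.congr fun n => ?_
    refine Finset.sum_congr rfl fun i _ => ?_
    ring

/-! ### Poisson's integral -/

lemma continuous_one_sub_sq_rpow {β : ℝ} (hβ : 0 < β) :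
    Continuous fun t : ℝ => (1 - t ^ 2) ^ β :=
  (by fun_prop : Continuous fun t : ℝ => 1 - t ^ 2).rpow_const fun _ => Or.inr hβ.le

/-- A Beta integral, simplified by the duplication formula. -/
lemma integral_one_sub_sq_rpow {β : ℝ} (hβ : 0 < β) :
    ∫ t in (-1 : ℝ)..1, (1 - t ^ 2) ^ β =
      √Real.pi * Real.Gamma (β + 1) / Real.Gamma (β + 1 / 2 + 1) := by
  have hB : ∫ u in (0 : ℝ)..1, u ^ β * (1 - u) ^ β =
      Real.Gamma (β + 1) * Real.Gamma (β + 1) / Real.Gamma (2 * (β + 1)) := by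
    have h := Complex.betaIntegral_eq_Gamma_mul_div ((β + 1 : ℝ) : ℂ) ((β + 1 : ℝ) : ℂ)
      (by simp; linarith) (by simp; linarith)
    rw [← Complex.ofReal_add, Complex.Gamma_ofReal, Complex.Gamma_ofReal,
      ← Complex.ofReal_mul, ← Complex.ofReal_div] at h
    have h2 : Complex.betaIntegral ((β + 1 : ℝ) : ℂ) ((β + 1 : ℝ) : ℂ) =
        ((∫ u in (0 : ℝ)..1, u ^ β * (1 - u) ^ β : ℝ) : ℂ) := by
      unfold Complex.betaIntegral
      rw [← intervalIntegral.integral_ofReal]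
      refine intervalIntegral.integral_congr fun u hu => ?_
      rw [uIcc_of_le zero_le_one] at hu
      simp only [Complex.ofReal_add, Complex.ofReal_one, add_sub_cancel_right, Complex.ofReal_mul]
      rw [Complex.ofReal_cpow hu.1, Complex.ofReal_cpow (by linarith [hu.2])]
      push_cast
      rfl
    rw [h2] at h
    have h3 := Complex.ofReal_injective h
    rw [h3]
    ring_nf
  have hsub : ∫ t in (-1 : ℝ)..1, (1 - t ^ 2) ^ β = 2 * 4 ^ β *
      ∫ u in (0 : ℝ)..1, u ^ β * (1 - u) ^ β := by
    have h := intervalIntegral.integral_comp_mul_sub (a := 0) (b := 1) (c := 2)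
      (fun t : ℝ => (1 - t ^ 2) ^ β) two_ne_zero 1
    norm_num at h
    rw [mul_assoc, ← intervalIntegral.integral_const_mul]
    have h' : ∫ u in (0 : ℝ)..1, 4 ^ β * (u ^ β * (1 - u) ^ β) =
        ∫ u in (0 : ℝ)..1, (1 - (2 * u - 1) ^ 2) ^ β := by
      refine intervalIntegral.integral_congr fun u hu => ?_
      rw [uIcc_of_le zero_le_one] at hu
      have h1 : 0 ≤ 1 - u := by linarith [hu.2]
      rw [← Real.mul_rpow hu.1 h1, ← Real.mul_rpow (by norm_num) (mul_nonneg hu.1 h1)]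
      congr 1
      ring
    rw [h', h]
    ring
  rw [hsub, hB]
  have hd := Real.Gamma_mul_Gamma_add_half (β + 1)
  have h4 : (2 : ℝ) ^ (1 - 2 * (β + 1)) = (2 * 4 ^ β)⁻¹ := by
    rw [show (4 : ℝ) = 2 ^ (2 : ℝ) by norm_num, ← Real.rpow_mul (by norm_num),
      ← Real.rpow_one_add' (by norm_num) (by positivity), ← Real.rpow_neg (by norm_num)]
    congr 1; ring
  rw [h4] at hd
  have hG2 : Real.Gamma (2 * (β + 1)) ≠ 0 := (Real.Gamma_pos_of_pos (by positivity)).ne'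
  have hG3 : Real.Gamma (β + 1 + 1 / 2) ≠ 0 := (Real.Gamma_pos_of_pos (by positivity)).ne'
  rw [show β + 1 / 2 + 1 = β + 1 + 1 / 2 by ring]
  have h5 : (4 : ℝ) ^ β ≠ 0 := (Real.rpow_pos_of_pos (by norm_num) _).ne'
  field_simp at hd ⊢
  linear_combination hd

/-- The even moments of the weight `(1 - t²)^β`. -/
lemma integral_pow_mul_one_sub_sq_rpow {β : ℝ} (hβ : 0 < β) (n : ℕ) :
    ∫ t in (-1 : ℝ)..1, t ^ (2 * n) * (1 - t ^ 2) ^ β =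
      √Real.pi * Real.Gamma (β + 1) * ((2 * n).factorial /
        (4 ^ n * (n.factorial * Real.Gamma (β + 1 / 2 + n + 1)))) := by
  induction n with
  | zero => simp [integral_one_sub_sq_rpow hβ, div_eq_mul_inv]
  | succ n ih =>
    have hc := continuous_one_sub_sq_rpow hβ
    have hi : ∀ m : ℕ, IntervalIntegrable (fun t : ℝ => t ^ m * (1 - t ^ 2) ^ β) volume (-1) 1 :=
      fun m => ((continuous_pow m).mul hc).intervalIntegrable _ _
    -- the derivative of `t^(2n+1) (1 - t²)^(β+1)` relates consecutive moments
    have hparts : (2 * n + 1 : ℝ) * (∫ t in (-1 : ℝ)..1, t ^ (2 * n) * (1 - t ^ 2) ^ β) =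
        (2 * n + 2 * β + 3) * ∫ t in (-1 : ℝ)..1, t ^ (2 * (n + 1)) * (1 - t ^ 2) ^ β := by
      have hd : ∀ t ∈ Ioo (-1 : ℝ) 1, HasDerivAt
          (fun t : ℝ => t ^ (2 * n + 1) * (1 - t ^ 2) ^ (β + 1))
          ((2 * n + 1 : ℝ) * (t ^ (2 * n) * (1 - t ^ 2) ^ β) -
            (2 * n + 2 * β + 3) * (t ^ (2 * (n + 1)) * (1 - t ^ 2) ^ β)) t := by
        intro t ht
        have hp : 0 < 1 - t ^ 2 := by nlinarith [ht.1, ht.2]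
        have h := (hasDerivAt_pow (2 * n + 1) t).mul
          ((((hasDerivAt_pow 2 t).const_sub 1)).rpow_const (p := β + 1) (Or.inl hp.ne'))
        refine h.congr_deriv ?_
        rw [add_sub_cancel_right, Real.rpow_add_one hp.ne']
        push_cast
        ring
      have h := intervalIntegral.integral_eq_sub_of_hasDerivAt_of_le (a := -1) (b := 1)
        (f := fun t : ℝ => t ^ (2 * n + 1) * (1 - t ^ 2) ^ (β + 1)) (by norm_num)
        (((continuous_pow (2 * n + 1)).mul
          (continuous_one_sub_sq_rpow (β := β + 1) (by linarith))).continuousOn) hd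
        (((hi _).const_mul _).sub ((hi _).const_mul _))
      rw [intervalIntegral.integral_sub ((hi _).const_mul _) ((hi _).const_mul _),
        intervalIntegral.integral_const_mul, intervalIntegral.integral_const_mul] at h
      simp only [one_pow, even_two.neg_pow, sub_self,
        Real.zero_rpow (by positivity : β + 1 ≠ 0), mul_zero] at h
      linarith
    rw [ih] at hparts
    have hG : Real.Gamma (β + 1 / 2 + n + 1 + 1) =
        (β + 1 / 2 + n + 1) * Real.Gamma (β + 1 / 2 + n + 1) := Real.Gamma_add_one (by positivity)
    have hG0 : Real.Gamma (β + 1 / 2 + n + 1) ≠ 0 := (Real.Gamma_pos_of_pos (by positivity)).ne'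
    have hf : (n.factorial : ℝ) ≠ 0 := by exact_mod_cast n.factorial_ne_zero
    have h23 : (2 * n + 2 * β + 3 : ℝ) ≠ 0 := by positivity
    rw [show β + 1 / 2 + ((n + 1 : ℕ) : ℝ) + 1 = β + 1 / 2 + n + 1 + 1 by push_cast; ring, hG,
      show 2 * (n + 1) = 2 * n + 1 + 1 by ring, Nat.factorial_succ, Nat.factorial_succ,
      Nat.factorial_succ, show 2 * n + 1 + 1 = 2 * (n + 1) by ring]
    refine mul_left_cancel₀ h23 (hparts.symm.trans ?_)
    push_cast
    have h6 : β + 1 / 2 + n + 1 ≠ 0 := by positivity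
    field_simp
    ring

/-- Poisson's integral for the Bessel function of order `β + 1/2`. -/
lemma integral_one_sub_sq_rpow_mul_cos {β : ℝ} (hβ : 0 < β) (x : ℝ) :
    ∫ t in (-1 : ℝ)..1, (1 - t ^ 2) ^ β * Real.cos (x * t) =
      √Real.pi * Real.Gamma (β + 1) * besselSeries (β + 1 / 2) (x ^ 2 / 4) := by
  have hc := continuous_one_sub_sq_rpow hβ
  have hsum : Summable fun n : ℕ => |x| ^ (2 * n) / ((2 * n).factorial : ℝ) :=
    (Real.summable_pow_div_factorial |x|).comp_injective
      (i := fun n : ℕ => 2 * n) (fun a b h => by simpa using h)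
  have h := intervalIntegral.hasSum_integral_of_dominated_convergence (a := -1) (b := 1)
    (μ := volume)
    (F := fun (n : ℕ) (t : ℝ) => (1 - t ^ 2) ^ β *
      ((-1) ^ n * (x * t) ^ (2 * n) / ((2 * n).factorial : ℝ)))
    (f := fun t : ℝ => (1 - t ^ 2) ^ β * Real.cos (x * t))
    (fun n _ => |x| ^ (2 * n) / ((2 * n).factorial : ℝ))
    (fun n => (hc.mul (by fun_prop)).aestronglyMeasurable)
    (fun n => ae_of_all _ fun t ht => by
      rw [uIoc_of_le (by norm_num)] at ht
      have ht' : |t| ≤ 1 := abs_le.2 ⟨ht.1.le, ht.2⟩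
      have h0 : 0 ≤ 1 - t ^ 2 := by nlinarith [abs_le.1 ht', sq_abs t, abs_nonneg t]
      have h1 : (1 - t ^ 2) ^ β ≤ 1 :=
        Real.rpow_le_one h0 (by nlinarith [sq_nonneg t]) hβ.le
      rw [Real.norm_eq_abs, abs_mul, abs_of_nonneg (Real.rpow_nonneg h0 _), abs_div, abs_mul,
        abs_pow, abs_neg, abs_one, one_pow, one_mul, abs_pow, abs_mul, Nat.abs_cast]
      have h2 : (|x| * |t|) ^ (2 * n) ≤ |x| ^ (2 * n) :=
        pow_le_pow_left₀ (by positivity) (mul_le_of_le_one_right (abs_nonneg x) ht') _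
      calc _ ≤ 1 * (|x| ^ (2 * n) / ((2 * n).factorial : ℝ)) := by gcongr
        _ = _ := one_mul _)
    (ae_of_all _ fun _ _ => hsum) (by simp)
    (ae_of_all _ fun t _ => (Real.hasSum_cos (x * t)).mul_left _)
  rw [← h.tsum_eq]
  unfold besselSeries
  rw [← tsum_mul_left]
  refine tsum_congr fun n => ?_
  have e : ∀ t : ℝ, (1 - t ^ 2) ^ β * ((-1) ^ n * (x * t) ^ (2 * n) / ((2 * n).factorial : ℝ)) =
      (-1) ^ n * x ^ (2 * n) / ((2 * n).factorial : ℝ) * (t ^ (2 * n) * (1 - t ^ 2) ^ β) := by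
    intro t; rw [mul_pow]; ring
  simp_rw [e]
  rw [intervalIntegral.integral_const_mul, integral_pow_mul_one_sub_sq_rpow hβ, div_pow, ← pow_mul]
  have hf : ((2 * n).factorial : ℝ) ≠ 0 := by exact_mod_cast (2 * n).factorial_ne_zero
  have hf' : (n.factorial : ℝ) ≠ 0 := by exact_mod_cast n.factorial_ne_zero
  have hG0 : Real.Gamma (β + 1 / 2 + n + 1) ≠ 0 := (Real.Gamma_pos_of_pos (by positivity)).ne'
  field_simp

lemma integral_zero_one_sub_sq_rpow_mul_cos {β : ℝ} (hβ : 0 < β) (x : ℝ) :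
    ∫ t in (0 : ℝ)..1, (1 - t ^ 2) ^ β * Real.cos (x * t) =
      √Real.pi * Real.Gamma (β + 1) / 2 * besselSeries (β + 1 / 2) (x ^ 2 / 4) := by
  have hc : Continuous fun t : ℝ => (1 - t ^ 2) ^ β * Real.cos (x * t) :=
    (continuous_one_sub_sq_rpow hβ).mul (by fun_prop)
  have h1 := intervalIntegral.integral_add_adjacent_intervals
    (hc.intervalIntegrable (μ := volume) (-1) 0) (hc.intervalIntegrable (μ := volume) 0 1)
  have h2 := intervalIntegral.integral_comp_neg (a := 0) (b := 1)
    (fun t : ℝ => (1 - t ^ 2) ^ β * Real.cos (x * t))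
  simp only [even_two.neg_pow, mul_neg, Real.cos_neg, neg_zero] at h2
  rw [← h2, integral_one_sub_sq_rpow_mul_cos hβ] at h1
  linarith

/-! ### The behaviour of `J_ν` at infinity -/

/-- The weight `(1 - w²)^β` on the half-line `w = 1 + i y`. -/
noncomputable def verticalWeight (β y : ℝ) : ℂ :=
  ((y : ℂ) ^ 2 - 2 * y * Complex.I) ^ (β : ℂ)

lemma norm_verticalWeight_le {β y : ℝ} (hβ : 0 < β) (hy : 0 ≤ y) :
    ‖verticalWeight β y‖ ≤ (y ^ 2 + 2 * y) ^ β := by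
  unfold verticalWeight
  rw [Complex.norm_cpow_real]
  refine Real.rpow_le_rpow (norm_nonneg _) ((norm_sub_le _ _).trans ?_) hβ.le
  simp [abs_of_nonneg hy]

lemma continuous_verticalWeight {β : ℝ} (hβ : 0 < β) : Continuous (verticalWeight β) := by
  refine continuous_iff_continuousAt.2 fun y => ?_
  refine ContinuousAt.comp (g := fun w : ℂ => w ^ (β : ℂ))
    (f := fun y : ℝ => (y : ℂ) ^ 2 - 2 * y * Complex.I) ?_ (by fun_prop)
  refine Complex.continuousAt_cpow_const_of_re_pos (Or.inl ?_) (by simpa using hβ)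
  have : ((y : ℂ) ^ 2 - 2 * y * Complex.I).re = y ^ 2 := by
    simp [← Complex.ofReal_pow]
  rw [this]; positivity

lemma integrableOn_rpow_mul_exp {β c : ℝ} (hβ : 0 < β) (hc : 0 < c) :
    IntegrableOn (fun y : ℝ => (y ^ 2 + 2 * y) ^ β * Real.exp (-c * y)) (Ioi 0) := by
  refine integrable_of_isBigO_exp_neg (b := c / 2) (by positivity) ?_ ?_
  · exact (((by fun_prop : Continuous fun y : ℝ => y ^ 2 + 2 * y).rpow_const
      fun _ => Or.inr hβ.le).mul (by fun_prop)).continuousOn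
  · have h := (isLittleO_rpow_exp_pos_mul_atTop (2 * β) (half_pos hc)).isBigO
    have h1 : (fun y : ℝ => (y ^ 2 + 2 * y) ^ β) =O[atTop] fun y : ℝ => y ^ (2 * β) := by
      refine Asymptotics.IsBigO.of_bound (3 ^ β) ?_
      filter_upwards [eventually_ge_atTop 1] with y hy
      have hy0 : 0 ≤ y := by linarith
      rw [Real.norm_of_nonneg (Real.rpow_nonneg (by positivity) _),
        Real.norm_of_nonneg (Real.rpow_nonneg hy0 _), Real.rpow_mul hy0,
        ← Real.mul_rpow (by norm_num) (Real.rpow_nonneg hy0 _)]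
      refine Real.rpow_le_rpow (by positivity) ?_ hβ.le
      rw [Real.rpow_two]
      nlinarith
    refine ((h1.trans h).mul (Asymptotics.isBigO_refl (fun y : ℝ => Real.exp (-c * y)) _)).congr_right
      fun y => ?_
    rw [← Real.exp_add]
    congr 1
    ring

lemma integrableOn_verticalWeight_mul_exp {β c : ℝ} (hβ : 0 < β) (hc : 0 < c) :
    IntegrableOn (fun y : ℝ => verticalWeight β y * (Real.exp (-c * y) : ℂ)) (Ioi 0) := by
  refine (integrableOn_rpow_mul_exp hβ hc).mono'
    (((continuous_verticalWeight hβ).mul (by fun_prop)).aestronglyMeasurable) ?_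
  refine (ae_restrict_iff' measurableSet_Ioi).2 (ae_of_all _ fun y hy => ?_)
  rw [norm_mul, Complex.norm_real, Real.norm_of_nonneg (Real.exp_pos _).le]
  exact mul_le_mul_of_nonneg_right (norm_verticalWeight_le hβ (le_of_lt hy)) (Real.exp_pos _).le

/-- Cauchy's theorem on the rectangle `[0, 1] × [0, R]`, in the limit `R → ∞`: the integral over the
left edge is purely imaginary, and the one over the top edge vanishes in the limit. -/
lemma integral_cos_eq_im {β x : ℝ} (hβ : 0 < β) (hx : 0 < x) :
    ∫ t in (0 : ℝ)..1, (1 - t ^ 2) ^ β * Real.cos (x * t) =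
      (Complex.exp (x * Complex.I) *
        ∫ y in Ioi (0 : ℝ), verticalWeight β y * (Real.exp (-x * y) : ℂ)).im := by
  set f : ℂ → ℂ := fun w => (1 - w ^ 2) ^ (β : ℂ) * Complex.exp (x * w * Complex.I) with hf
  have hre : ∀ u v : ℝ, (1 - ((u : ℂ) + v * Complex.I) ^ 2).re = 1 - u ^ 2 + v ^ 2 := by
    intro u v
    simp [pow_two]
    ring
  have hrect : ∀ R : ℝ, 0 < R →
      (∫ t in (0 : ℝ)..1, (1 - t ^ 2) ^ β * Real.cos (x * t)) -
        (∫ t in (0 : ℝ)..1, f (t + R * Complex.I)).re -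
        (Complex.exp (x * Complex.I) *
          ∫ y in (0 : ℝ)..R, verticalWeight β y * (Real.exp (-x * y) : ℂ)).im = 0 := by
    intro R hR
    have h := Complex.integral_boundary_rect_eq_zero_of_continuousOn_of_differentiableOn f 0
      (1 + R * Complex.I) ?_ ?_
    · simp only [Complex.zero_re, Complex.zero_im, Complex.add_re, Complex.one_re,
        Complex.mul_re, Complex.ofReal_re, Complex.I_re, Complex.ofReal_im, Complex.I_im,
        Complex.add_im, Complex.one_im, Complex.mul_im, mul_zero, mul_one, zero_add, add_zero,
        sub_self, Complex.ofReal_zero, zero_mul, Complex.ofReal_one, smul_eq_mul] at h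
      have hbot : (∫ t in (0 : ℝ)..1, f t).re =
          ∫ t in (0 : ℝ)..1, (1 - t ^ 2) ^ β * Real.cos (x * t) := by
        have hi : IntervalIntegrable (fun t : ℝ => (((1 - t ^ 2) ^ β : ℝ) : ℂ) *
            Complex.exp (x * t * Complex.I)) volume 0 1 :=
          ((Complex.continuous_ofReal.comp (continuous_one_sub_sq_rpow hβ)).mul
            (by fun_prop)).intervalIntegrable _ _
        have e : ∫ t in (0 : ℝ)..1, f t = ∫ t in (0 : ℝ)..1, (((1 - t ^ 2) ^ β : ℝ) : ℂ) *
            Complex.exp (x * t * Complex.I) := by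
          refine intervalIntegral.integral_congr fun t ht => ?_
          rw [uIcc_of_le zero_le_one] at ht
          have h0 : 0 ≤ 1 - t ^ 2 := by nlinarith [ht.1, ht.2]
          simp only [hf, Complex.ofReal_cpow h0, Complex.ofReal_sub, Complex.ofReal_one,
            Complex.ofReal_pow]
        rw [e]
        have h2 := Complex.reCLM.intervalIntegral_comp_comm hi
        simp only [Complex.reCLM_apply] at h2
        rw [← h2]
        refine intervalIntegral.integral_congr fun t _ => ?_
        simp only [Complex.re_ofReal_mul]
        rw [← Complex.ofReal_mul, Complex.exp_ofReal_mul_I_re]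
      have hleft : (Complex.I * ∫ y in (0 : ℝ)..R, f (y * Complex.I)).re = 0 := by
        have e : ∫ y in (0 : ℝ)..R, f (y * Complex.I) =
            ((∫ y in (0 : ℝ)..R, (1 + y ^ 2) ^ β * Real.exp (-x * y) : ℝ) : ℂ) := by
          rw [← intervalIntegral.integral_ofReal]
          refine intervalIntegral.integral_congr fun y _ => ?_
          simp only [hf, Complex.ofReal_mul, Complex.ofReal_exp]
          rw [Complex.ofReal_cpow (by positivity)]
          congr 2
          · push_cast; ring_nf; simp
          · push_cast; ring_nf; simp
        rw [e]
        simp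
      have hright : (∫ y in (0 : ℝ)..R, f (1 + y * Complex.I)) = Complex.exp (x * Complex.I) *
          ∫ y in (0 : ℝ)..R, verticalWeight β y * (Real.exp (-x * y) : ℂ) := by
        rw [← intervalIntegral.integral_const_mul]
        refine intervalIntegral.integral_congr fun y _ => ?_
        simp only [hf, verticalWeight, Complex.ofReal_exp]
        rw [mul_left_comm, ← Complex.exp_add]
        congr 2
        · ring_nf; simp
        · push_cast; ring_nf; simp
      have h' := congrArg Complex.re h
      rw [hright] at h'
      simp only [Complex.add_re, Complex.sub_re, hleft, hbot, Complex.zero_re, Complex.I_mul_re,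
        sub_zero] at h'
      linarith
    · intro w hw
      have hw' : 0 ≤ w.re ∧ w.re ≤ 1 := by
        have := hw.1
        simpa [uIcc_of_le, mem_preimage] using this
      refine ContinuousAt.continuousWithinAt (ContinuousAt.mul ?_ (by fun_prop))
      refine ContinuousAt.comp (g := fun w : ℂ => w ^ (β : ℂ)) (f := fun w : ℂ => 1 - w ^ 2)
        ?_ (by fun_prop)
      refine Complex.continuousAt_cpow_const_of_re_pos (Or.inl ?_) (by simpa using hβ)
      rw [← Complex.re_add_im w, hre]
      nlinarith [sq_nonneg w.im]
    · intro w hw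
      have hw' : 0 < w.re ∧ w.re < 1 := by
        have := hw.1
        simpa [mem_preimage] using this
      refine DifferentiableAt.differentiableWithinAt (DifferentiableAt.mul ?_ (by fun_prop))
      refine DifferentiableAt.cpow (by fun_prop) (by fun_prop) (Or.inl ?_)
      rw [← Complex.re_add_im w, hre]
      nlinarith [sq_nonneg w.im]
  have htop : Tendsto (fun R : ℝ => ∫ t in (0 : ℝ)..1, f (t + R * Complex.I)) atTop (𝓝 0) := by
    have hlim : Tendsto (fun R : ℝ => (4 : ℝ) ^ β * (R ^ (2 * β) * Real.exp (-x * R))) atTop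
        (𝓝 0) := by
      simpa using (tendsto_rpow_mul_exp_neg_mul_atTop_nhds_zero (2 * β) x hx).const_mul
        ((4 : ℝ) ^ β)
    refine squeeze_zero_norm' ?_ hlim
    filter_upwards [eventually_ge_atTop 2] with R hR
    have hR0 : 0 ≤ R := by linarith
    refine (intervalIntegral.norm_integral_le_of_norm_le_const
      (C := (4 : ℝ) ^ β * (R ^ (2 * β) * Real.exp (-x * R))) fun t ht => ?_).trans (by simp)
    rw [uIoc_of_le zero_le_one] at ht
    simp only [hf]
    rw [norm_mul, Complex.norm_cpow_real, Complex.norm_exp, ← mul_assoc]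
    have e1 : (x * (t + R * Complex.I) * Complex.I).re = -x * R := by
      simp
    rw [e1]
    refine mul_le_mul_of_nonneg_right ?_ (Real.exp_pos _).le
    rw [Real.rpow_mul hR0, ← Real.mul_rpow (by norm_num) (Real.rpow_nonneg hR0 _)]
    refine Real.rpow_le_rpow (norm_nonneg _) ?_ hβ.le
    have h3 : ‖(t : ℂ) + R * Complex.I‖ ≤ 1 + R := by
      refine (norm_add_le _ _).trans ?_
      simp only [Complex.norm_real, norm_mul, Complex.norm_I, mul_one, Real.norm_eq_abs,
        abs_of_nonneg hR0, abs_of_pos ht.1]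
      linarith [ht.2]
    have h4 : ‖1 - ((t : ℂ) + R * Complex.I) ^ 2‖ ≤ 1 + (1 + R) ^ 2 := by
      refine (norm_sub_le _ _).trans ?_
      rw [norm_one, norm_pow]
      gcongr
    rw [Real.rpow_two]
    nlinarith
  have hside := (intervalIntegral_tendsto_integral_Ioi 0
    (integrableOn_verticalWeight_mul_exp hβ hx) tendsto_id).const_mul (Complex.exp (x * Complex.I))
  have hfin := (tendsto_const_nhds (x := ∫ t in (0 : ℝ)..1, (1 - t ^ 2) ^ β * Real.cos (x * t))
    (f := atTop)).sub ((Complex.continuous_re.tendsto _).comp htop) |>.sub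
    ((Complex.continuous_im.tendsto _).comp hside)
  have hz := tendsto_nhds_unique (hfin.congr' (f₂ := fun _ => (0 : ℝ)) (by
    filter_upwards [eventually_gt_atTop 0] with R hR
    exact hrect R hR)) tendsto_const_nhds
  simp only [Complex.zero_re, sub_zero] at hz
  linarith

lemma cpow_ofReal_mul {r : ℝ} (hr : 0 < r) (w : ℂ) {β : ℝ} (hβ : 0 < β) :
    ((r : ℂ) * w) ^ (β : ℂ) = (r : ℂ) ^ (β : ℂ) * w ^ (β : ℂ) := by
  have hβ' : (β : ℂ) ≠ 0 := by exact_mod_cast hβ.ne'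
  rcases eq_or_ne w 0 with rfl | hw
  · simp [Complex.zero_cpow hβ']
  · have hr' : (r : ℂ) ≠ 0 := by exact_mod_cast hr.ne'
    rw [Complex.cpow_def_of_ne_zero (mul_ne_zero hr' hw), Complex.cpow_def_of_ne_zero hr',
      Complex.cpow_def_of_ne_zero hw, Complex.log_ofReal_mul hr hw, ← Complex.ofReal_log hr.le,
      ← Complex.exp_add]
    ring_nf

/-- Watson's lemma for the integral over the vertical half-line. -/
lemma tendsto_integral_verticalWeight {β : ℝ} (hβ : 0 < β) :
    Tendsto (fun x : ℝ => ((x ^ (β + 1) : ℝ) : ℂ) *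
      ∫ y in Ioi (0 : ℝ), verticalWeight β y * (Real.exp (-x * y) : ℂ)) atTop
      (𝓝 ((-2 * Complex.I) ^ (β : ℂ) * Real.Gamma (β + 1))) := by
  have hlim : Tendsto (fun x : ℝ => ∫ s in Ioi (0 : ℝ),
      ((s : ℂ) ^ 2 * ((x⁻¹ : ℝ) : ℂ) - 2 * s * Complex.I) ^ (β : ℂ) * (Real.exp (-1 * s) : ℂ)) atTop
      (𝓝 (∫ s in Ioi (0 : ℝ), (s * (-2 * Complex.I)) ^ (β : ℂ) * (Real.exp (-1 * s) : ℂ))) := by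
    refine tendsto_integral_filter_of_dominated_convergence
      (fun s : ℝ => (s ^ 2 + 2 * s) ^ β * Real.exp (-1 * s)) ?_ ?_
      (integrableOn_rpow_mul_exp hβ one_pos) ?_
    · filter_upwards [eventually_gt_atTop 0] with x hx
      refine Continuous.aestronglyMeasurable (Continuous.mul ?_ (by fun_prop))
      refine continuous_iff_continuousAt.2 fun s => ?_
      refine ContinuousAt.comp (g := fun w : ℂ => w ^ (β : ℂ))
        (f := fun s : ℝ => (s : ℂ) ^ 2 * ((x⁻¹ : ℝ) : ℂ) - 2 * s * Complex.I) ?_ (by fun_prop)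
      refine Complex.continuousAt_cpow_const_of_re_pos (Or.inl ?_) (by simpa using hβ)
      have : ((s : ℂ) ^ 2 * ((x⁻¹ : ℝ) : ℂ) - 2 * s * Complex.I).re = s ^ 2 * x⁻¹ := by
        rw [← Complex.ofReal_pow, ← Complex.ofReal_mul, Complex.sub_re, Complex.ofReal_re]
        simp
      rw [this]; positivity
    · filter_upwards [eventually_ge_atTop 1] with x hx
      refine (ae_restrict_iff' measurableSet_Ioi).2 (ae_of_all _ fun s hs => ?_)
      have hs' : (0 : ℝ) < s := hs
      have hx0 : 0 < x := by linarith
      rw [norm_mul, Complex.norm_real, Real.norm_of_nonneg (Real.exp_pos _).le,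
        Complex.norm_cpow_real]
      refine mul_le_mul_of_nonneg_right (Real.rpow_le_rpow (norm_nonneg _)
        ((norm_sub_le _ _).trans ?_) hβ.le) (Real.exp_pos _).le
      have h1 : x⁻¹ ≤ 1 := inv_le_one_of_one_le₀ hx
      have h2 : ‖(s : ℂ) ^ 2 * ((x⁻¹ : ℝ) : ℂ)‖ = s ^ 2 * x⁻¹ := by
        rw [norm_mul, norm_pow, Complex.norm_real, Complex.norm_real, Real.norm_of_nonneg hs'.le,
          Real.norm_of_nonneg (by positivity)]
      have h3 : ‖2 * (s : ℂ) * Complex.I‖ = 2 * s := by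
        simp [abs_of_pos hs']
      rw [h2, h3]
      nlinarith [sq_nonneg s]
    · refine (ae_restrict_iff' measurableSet_Ioi).2 (ae_of_all _ fun s hs => ?_)
      have hs' : (0 : ℝ) < s := hs
      refine Tendsto.mul_const _ ?_
      have hcont : ContinuousAt (fun w : ℂ => w ^ (β : ℂ)) (s * (-2 * Complex.I)) := by
        refine ContinuousAt.cpow continuousAt_id continuousAt_const (Or.inr ?_)
        simp [hs'.ne']
      refine hcont.tendsto.comp ?_
      have h1 : Tendsto (fun x : ℝ => (s : ℂ) ^ 2 * ((x⁻¹ : ℝ) : ℂ) - 2 * s * Complex.I) atTop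
          (𝓝 ((s : ℂ) ^ 2 * ((0 : ℝ) : ℂ) - 2 * s * Complex.I)) :=
        ((((Complex.continuous_ofReal.tendsto 0).comp tendsto_inv_atTop_zero).const_mul _).sub_const _)
      convert h1 using 2
      push_cast
      ring
  have hval : ∫ s in Ioi (0 : ℝ), (s * (-2 * Complex.I)) ^ (β : ℂ) * (Real.exp (-1 * s) : ℂ) =
      (-2 * Complex.I) ^ (β : ℂ) * Real.Gamma (β + 1) := by
    rw [Real.Gamma_eq_integral (by linarith), ← integral_complex_ofReal, ← integral_const_mul]
    refine setIntegral_congr_fun measurableSet_Ioi fun s hs => ?_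
    have hs' : (0 : ℝ) < s := hs
    rw [cpow_ofReal_mul hs' _ hβ, add_sub_cancel_right, Complex.ofReal_mul,
      Complex.ofReal_cpow hs'.le, neg_one_mul]
    ring
  rw [← hval]
  refine hlim.congr' ?_
  filter_upwards [eventually_gt_atTop 0] with x hx
  have h := integral_comp_mul_left_Ioi (fun s : ℝ =>
    ((s : ℂ) ^ 2 * ((x⁻¹ : ℝ) : ℂ) - 2 * s * Complex.I) ^ (β : ℂ) * (Real.exp (-1 * s) : ℂ)) 0 hx
  rw [mul_zero] at h
  have h' : ∫ s in Ioi (0 : ℝ), ((s : ℂ) ^ 2 * ((x⁻¹ : ℝ) : ℂ) - 2 * s * Complex.I) ^ (β : ℂ) *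
      (Real.exp (-1 * s) : ℂ) = x • ∫ y in Ioi (0 : ℝ), (((x * y : ℝ) : ℂ) ^ 2 * ((x⁻¹ : ℝ) : ℂ) -
        2 * ((x * y : ℝ) : ℂ) * Complex.I) ^ (β : ℂ) * (Real.exp (-1 * (x * y)) : ℂ) := by
    rw [h, smul_smul, mul_inv_cancel₀ hx.ne', one_smul]
  rw [h', Real.rpow_add_one hx.ne', Complex.real_smul, ← integral_const_mul, ← integral_const_mul]
  refine integral_congr_ae (ae_of_all _ fun y => ?_)
  have hx' : (x : ℂ) ≠ 0 := by exact_mod_cast hx.ne'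
  have e : ((x * y : ℝ) : ℂ) ^ 2 * ((x⁻¹ : ℝ) : ℂ) - 2 * ((x * y : ℝ) : ℂ) * Complex.I =
      (x : ℂ) * ((y : ℂ) ^ 2 - 2 * y * Complex.I) := by
    push_cast
    field_simp
  simp only
  rw [e, cpow_ofReal_mul hx _ hβ, Complex.ofReal_mul, Complex.ofReal_cpow hx.le, verticalWeight]
  ring_nf

/-- `√x J_ν(x) = Im (e^{ix} C(x))` with `C(x)` convergent; the limit is the Hankel amplitude. -/
noncomputable def hankelAmplitude (β x : ℝ) : ℂ :=
  ((2 ^ (1 / 2 - β) / (√Real.pi * Real.Gamma (β + 1)) : ℝ) : ℂ) * (((x ^ (β + 1) : ℝ) : ℂ) *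
    ∫ y in Ioi (0 : ℝ), verticalWeight β y * (Real.exp (-x * y) : ℂ))

lemma tendsto_hankelAmplitude {β : ℝ} (hβ : 0 < β) :
    Tendsto (hankelAmplitude β) atTop
      (𝓝 (((2 ^ (1 / 2 - β) / √Real.pi : ℝ) : ℂ) * (-2 * Complex.I) ^ (β : ℂ))) := by
  have h := (tendsto_integral_verticalWeight hβ).const_mul
    ((2 ^ (1 / 2 - β) / (√Real.pi * Real.Gamma (β + 1)) : ℝ) : ℂ)
  have e : ((2 ^ (1 / 2 - β) / √Real.pi : ℝ) : ℂ) * (-2 * Complex.I) ^ (β : ℂ) =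
      ((2 ^ (1 / 2 - β) / (√Real.pi * Real.Gamma (β + 1)) : ℝ) : ℂ) *
        ((-2 * Complex.I) ^ (β : ℂ) * Real.Gamma (β + 1)) := by
    have hG : Real.Gamma (β + 1) ≠ 0 := (Real.Gamma_pos_of_pos (by positivity)).ne'
    have hG' : (Real.Gamma (β + 1) : ℂ) ≠ 0 := by exact_mod_cast hG
    have hp : (√Real.pi : ℂ) ≠ 0 := by
      exact_mod_cast (Real.sqrt_pos.2 Real.pi_pos).ne'
    push_cast
    field_simp
  rw [e]
  exact h

lemma sqrt_mul_besselJ {β x : ℝ} (hβ : 0 < β) (hx : 0 < x) :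
    √x * besselJ (β + 1 / 2) x = (Complex.exp (x * Complex.I) * hankelAmplitude β x).im := by
  have h1 := integral_zero_one_sub_sq_rpow_mul_cos hβ x
  rw [integral_cos_eq_im hβ hx] at h1
  have hG : Real.Gamma (β + 1) ≠ 0 := (Real.Gamma_pos_of_pos (by positivity)).ne'
  have hp : √Real.pi ≠ 0 := (Real.sqrt_pos.2 Real.pi_pos).ne'
  have e : Complex.exp (x * Complex.I) * hankelAmplitude β x =
      ((2 ^ (1 / 2 - β) / (√Real.pi * Real.Gamma (β + 1)) * x ^ (β + 1) : ℝ) : ℂ) *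
      (Complex.exp (x * Complex.I) *
        ∫ y in Ioi (0 : ℝ), verticalWeight β y * (Real.exp (-x * y) : ℂ)) := by
    unfold hankelAmplitude
    push_cast
    ring
  have e' : x ^ (β + 1) = √x * x ^ (β + 1 / 2) := by
    rw [Real.sqrt_eq_rpow, ← Real.rpow_add hx]
    ring_nf
  rw [e, Complex.im_ofReal_mul, h1, besselJ_eq, Real.div_rpow hx.le (by norm_num), e',
    show (1 / 2 - β : ℝ) = 1 - (β + 1 / 2) by ring, Real.rpow_sub (by norm_num)]
  have h2 : (2 : ℝ) ^ (β + 1 / 2) ≠ 0 := (Real.rpow_pos_of_pos (by norm_num) _).ne'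
  rw [Real.rpow_one]
  field_simp

lemma tendsto_im_sq_sub {C : ℝ → ℂ} {c : ℂ} (h : Tendsto C atTop (𝓝 c)) :
    Tendsto (fun x : ℝ => (Complex.exp (x * Complex.I) * C x).im ^ 2 -
      (Complex.exp (x * Complex.I) * c).im ^ 2) atTop (𝓝 0) := by
  have hb : Tendsto (fun x => ‖C x - c‖ * ‖C x + c‖) atTop (𝓝 0) := by
    have h1 : Tendsto (fun x => ‖C x - c‖) atTop (𝓝 ‖c - c‖) := (h.sub_const c).norm
    have h2 : Tendsto (fun x => ‖C x + c‖) atTop (𝓝 ‖c + c‖) := (h.add_const c).norm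
    simpa using h1.mul h2
  refine squeeze_zero_norm (fun x => ?_) hb
  have e : (Complex.exp (x * Complex.I) * C x).im ^ 2 - (Complex.exp (x * Complex.I) * c).im ^ 2 =
      (Complex.exp (x * Complex.I) * (C x - c)).im *
        (Complex.exp (x * Complex.I) * (C x + c)).im := by
    rw [mul_sub, mul_add, Complex.sub_im, Complex.add_im]
    ring
  have hn : ∀ w : ℂ, |(Complex.exp (x * Complex.I) * w).im| ≤ ‖w‖ := fun w =>
    (Complex.abs_im_le_norm _).trans (by rw [norm_mul, Complex.norm_exp_ofReal_mul_I, one_mul])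
  rw [e, Real.norm_eq_abs, abs_mul]
  exact mul_le_mul (hn _) (hn _) (abs_nonneg _) (norm_nonneg _)

lemma tendsto_besselJ_sq_add_of_half_lt {ν : ℝ} (hν : 1 / 2 < ν) :
    Tendsto (fun x => x * (besselJ ν x ^ 2 + besselJ (ν + 1) x ^ 2)) atTop (𝓝 (2 / Real.pi)) := by
  obtain ⟨β, hβ, rfl⟩ : ∃ β : ℝ, 0 < β ∧ ν = β + 1 / 2 := ⟨ν - 1 / 2, by linarith, by ring⟩
  set c : ℂ := ((2 ^ (1 / 2 - β) / √Real.pi : ℝ) : ℂ) * (-2 * Complex.I) ^ (β : ℂ) with hc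
  have h2 : ((2 ^ (1 / 2 - (β + 1)) / √Real.pi : ℝ) : ℂ) * (-2 * Complex.I) ^ ((β + 1 : ℝ) : ℂ) =
      -Complex.I * c := by
    have hI : (-2 * Complex.I) ≠ 0 := by simp
    rw [hc, Complex.ofReal_add, Complex.cpow_add _ _ hI, Complex.ofReal_one, Complex.cpow_one,
      show (1 / 2 - (β + 1) : ℝ) = 1 / 2 - β - 1 by ring, Real.rpow_sub_one (by norm_num)]
    push_cast
    ring
  have t1 := tendsto_im_sq_sub (tendsto_hankelAmplitude hβ)
  have t2 := tendsto_im_sq_sub (tendsto_hankelAmplitude (β := β + 1) (by linarith))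
  rw [h2] at t2
  rw [← hc] at t1
  have hnorm : ‖c‖ ^ 2 = 2 / Real.pi := by
    rw [hc, norm_mul, Complex.norm_cpow_real, Complex.norm_real, norm_mul, Complex.norm_I, norm_neg,
      Complex.norm_ofNat, mul_one, Real.norm_of_nonneg (by positivity), div_mul_eq_mul_div,
      ← Real.rpow_add (by norm_num), sub_add_cancel, div_pow, Real.sq_sqrt Real.pi_pos.le,
      ← Real.rpow_natCast, ← Real.rpow_mul (by norm_num)]
    norm_num
  have t := (t1.add t2).add_const (‖c‖ ^ 2)
  rw [hnorm, zero_add, zero_add] at t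
  refine t.congr' ?_
  filter_upwards [eventually_gt_atTop 0] with x hx
  have e1 := sqrt_mul_besselJ hβ hx
  have e2 := sqrt_mul_besselJ (β := β + 1) (by linarith) hx
  rw [show β + 1 + 1 / 2 = β + 1 / 2 + 1 by ring] at e2
  have e3 : (Complex.exp (x * Complex.I) * c).im ^ 2 +
      (Complex.exp (x * Complex.I) * (-Complex.I * c)).im ^ 2 = ‖c‖ ^ 2 := by
    have : ‖Complex.exp (x * Complex.I) * c‖ ^ 2 = ‖c‖ ^ 2 := by
      rw [norm_mul, Complex.norm_exp_ofReal_mul_I, one_mul]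
    rw [← this, Complex.sq_norm, Complex.normSq_apply, mul_left_comm _ (-Complex.I), neg_mul,
      Complex.neg_im, Complex.I_mul_im]
    ring
  have e4 : √x ^ 2 = x := Real.sq_sqrt hx.le
  rw [← e1, ← e2, ← hnorm, ← e3]
  nlinarith [e4]

/-- Perturbing the coefficients of a quadratic form along bounded arguments. -/
lemma tendsto_quadratic {p q A B C : ℝ → ℝ} {l : ℝ}
    (h : Tendsto (fun x => p x ^ 2 + q x ^ 2) atTop (𝓝 l)) (hA : Tendsto A atTop (𝓝 1))
    (hB : Tendsto B atTop (𝓝 0)) (hC : Tendsto C atTop (𝓝 1)) :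
    Tendsto (fun x => A x * p x ^ 2 + B x * (p x * q x) + C x * q x ^ 2) atTop (𝓝 l) := by
  have hb : Tendsto (fun x => (|A x - 1| + |B x| + |C x - 1|) * (p x ^ 2 + q x ^ 2)) atTop
      (𝓝 0) := by
    have h1 : Tendsto (fun x => |A x - 1|) atTop (𝓝 |(1 : ℝ) - 1|) := (hA.sub_const 1).abs
    have h2 : Tendsto (fun x => |C x - 1|) atTop (𝓝 |(1 : ℝ) - 1|) := (hC.sub_const 1).abs
    have h3 : Tendsto (fun x => |B x|) atTop (𝓝 |(0 : ℝ)|) := hB.abs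
    simpa using ((h1.add h3).add h2).mul h
  have hz : Tendsto (fun x => (A x - 1) * p x ^ 2 + B x * (p x * q x) + (C x - 1) * q x ^ 2) atTop
      (𝓝 0) := by
    refine squeeze_zero_norm (fun x => ?_) hb
    have hpq : |p x * q x| ≤ p x ^ 2 + q x ^ 2 := by
      rw [abs_le]; constructor <;> nlinarith [sq_nonneg (p x + q x), sq_nonneg (p x - q x)]
    calc ‖(A x - 1) * p x ^ 2 + B x * (p x * q x) + (C x - 1) * q x ^ 2‖
        ≤ ‖(A x - 1) * p x ^ 2‖ + ‖B x * (p x * q x)‖ + ‖(C x - 1) * q x ^ 2‖ := norm_add₃_le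
      _ = |A x - 1| * p x ^ 2 + |B x| * |p x * q x| + |C x - 1| * q x ^ 2 := by
          simp only [Real.norm_eq_abs, abs_mul, abs_pow, sq_abs]
      _ ≤ _ := by
          nlinarith [mul_le_mul_of_nonneg_left hpq (abs_nonneg (B x)),
            mul_nonneg (abs_nonneg (A x - 1)) (sq_nonneg (q x)),
            mul_nonneg (abs_nonneg (C x - 1)) (sq_nonneg (p x))]
  have := hz.add h
  rw [zero_add] at this
  refine this.congr fun x => ?_
  ring

lemma tendsto_const_div_atTop (a : ℝ) : Tendsto (fun x : ℝ => a / x) atTop (𝓝 0) :=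
  tendsto_const_nhds.div_atTop tendsto_id

/-- The amplitude of `J_ν` at infinity, for every `ν > 0`: the recurrence carries the case
`ν > 1/2` down. -/
lemma tendsto_besselJ_sq_add {ν : ℝ} (hν : 0 < ν) :
    Tendsto (fun x => x * (besselJ ν x ^ 2 + besselJ (ν + 1) x ^ 2)) atTop (𝓝 (2 / Real.pi)) := by
  have h := tendsto_besselJ_sq_add_of_half_lt (ν := ν + 1) (by linarith)
  have h' : Tendsto (fun x => (√x * besselJ (ν + 1) x) ^ 2 + (√x * besselJ (ν + 2) x) ^ 2) atTop
      (𝓝 (2 / Real.pi)) := by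
    refine h.congr' ?_
    filter_upwards [eventually_gt_atTop 0] with x hx
    rw [mul_pow, mul_pow, Real.sq_sqrt hx.le, show ν + 1 + 1 = ν + 2 by ring]
    ring
  have t0 := tendsto_const_div_atTop (2 * (ν + 1))
  have hA : Tendsto (fun x : ℝ => 1 + (2 * (ν + 1) / x) ^ 2) atTop (𝓝 1) := by
    simpa using (t0.pow 2).const_add 1
  have hB : Tendsto (fun x : ℝ => -2 * (2 * (ν + 1) / x)) atTop (𝓝 0) := by
    simpa using t0.const_mul (-2)
  refine (tendsto_quadratic h' hA hB tendsto_const_nhds).congr' ?_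
  filter_upwards [eventually_gt_atTop 0] with x hx
  have e4 : √x ^ 2 = x := Real.sq_sqrt hx.le
  have e5 : besselJ ν x = 2 * (ν + 1) / x * besselJ (ν + 1) x - besselJ (ν + 2) x := by
    rw [besselJ_recurrence hν.le hx]; ring
  rw [e5]
  simp only [mul_pow, e4]
  linear_combination (-2 * (2 * (ν + 1) / x) * besselJ (ν + 1) x * besselJ (ν + 2) x) * e4

lemma tendsto_besselJ_sq_add_besselEuler {ν : ℝ} (hν : 0 < ν) :
    Tendsto (fun x => (√x * besselJ ν x) ^ 2 + (besselEuler ν x / √x) ^ 2) atTop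
      (𝓝 (2 / Real.pi)) := by
  have h' : Tendsto (fun x => (√x * besselJ ν x) ^ 2 + (√x * besselJ (ν + 1) x) ^ 2) atTop
      (𝓝 (2 / Real.pi)) := by
    refine (tendsto_besselJ_sq_add hν).congr' ?_
    filter_upwards [eventually_gt_atTop 0] with x hx
    rw [mul_pow, mul_pow, Real.sq_sqrt hx.le]
    ring
  have t0 := tendsto_const_div_atTop ν
  have hA : Tendsto (fun x : ℝ => 1 + (ν / x) ^ 2) atTop (𝓝 1) := by
    simpa using (t0.pow 2).const_add 1
  have hB : Tendsto (fun x : ℝ => -2 * (ν / x)) atTop (𝓝 0) := by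
    simpa using t0.const_mul (-2)
  refine (tendsto_quadratic h' hA hB tendsto_const_nhds).congr' ?_
  filter_upwards [eventually_gt_atTop 0] with x hx
  have e4 : √x ^ 2 = x := Real.sq_sqrt hx.le
  have h0 : √x ≠ 0 := (Real.sqrt_pos.2 hx).ne'
  unfold besselEuler
  simp only [mul_pow, div_pow, e4]
  field_simp
  rw [e4]
  ring

/-! ### Sonin-type amplitude bounds -/

lemma le_of_deriv_nonneg_of_tendsto {E E' : ℝ → ℝ} {a l x : ℝ}
    (hd : ∀ y, a < y → HasDerivAt E (E' y) y) (hE : ∀ y, a < y → 0 ≤ E' y)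
    (hl : Tendsto E atTop (𝓝 l)) (hx : a < x) : E x ≤ l := by
  have hm : MonotoneOn E (Ioi a) := by
    refine monotoneOn_of_deriv_nonneg (convex_Ioi a)
      (fun y hy => (hd y hy).continuousAt.continuousWithinAt)
      (fun y hy => (hd y (interior_subset hy)).differentiableAt.differentiableWithinAt)
      fun y hy => ?_
    rw [(hd y (interior_subset hy)).deriv]
    exact hE y (interior_subset hy)
  refine ge_of_tendsto hl ?_
  filter_upwards [eventually_ge_atTop x] with y hy
  exact hm hx (hx.trans_le hy) hy

/-- For `ν ≤ 1/2`, `u = √x J_ν` satisfies `u'' + q u = 0` with `q = 1 + (1/4 - ν²)/x²` decreasing,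
so `u² + u'²/q` increases to its limit `2/π`. -/
lemma mul_besselJ_sq_le {ν : ℝ} (hν : 0 < ν) (hν' : ν ≤ 1 / 2) {x : ℝ} (hx : 0 < x) :
    x * besselJ ν x ^ 2 ≤ 2 / Real.pi := by
  set m : ℝ := 1 / 4 - ν ^ 2 with hm
  have hm0 : 0 ≤ m := by nlinarith
  have hd : ∀ y : ℝ, 0 < y → HasDerivAt
      (fun y => y * besselJ ν y ^ 2 +
        y * (besselEuler ν y + besselJ ν y / 2) ^ 2 / (y ^ 2 + m))
      (2 * m * (besselEuler ν y + besselJ ν y / 2) ^ 2 / (y ^ 2 + m) ^ 2) y := by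
    intro y hy
    have hJ := hasDerivAt_besselJ_euler hν.le hy
    have hP := hasDerivAt_besselEuler hν.le hy
    have hq : y ^ 2 + m ≠ 0 := by positivity
    have h := ((hasDerivAt_id y).mul (hJ.pow 2)).add
      (((hasDerivAt_id y).mul ((hP.add (hJ.div_const 2)).pow 2)).div
        ((hasDerivAt_pow 2 y).add_const m) hq)
    refine h.congr_deriv ?_
    simp only [id_eq, Pi.mul_apply, Pi.pow_apply, Pi.add_apply]
    have e : ν ^ 2 = 1 / 4 - m := by rw [hm]; ring
    rw [e]
    field_simp
    push_cast
    ring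
  have hlim : Tendsto (fun y => y * besselJ ν y ^ 2 +
        y * (besselEuler ν y + besselJ ν y / 2) ^ 2 / (y ^ 2 + m)) atTop (𝓝 (2 / Real.pi)) := by
    have t1 : Tendsto (fun y : ℝ => 1 + m * (1 / y) ^ 2) atTop (𝓝 1) := by
      simpa using (((tendsto_const_div_atTop 1).pow 2).const_mul m).const_add 1
    have t2 : Tendsto (fun y : ℝ => (1 + m * (1 / y) ^ 2)⁻¹) atTop (𝓝 1) := by
      simpa using t1.inv₀ one_ne_zero
    have hA : Tendsto (fun y : ℝ => 1 + (1 + m * (1 / y) ^ 2)⁻¹ * (1 / 2 / y) ^ 2) atTop (𝓝 1) := by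
      simpa using (t2.mul ((tendsto_const_div_atTop (1 / 2)).pow 2)).const_add 1
    have hB : Tendsto (fun y : ℝ => (1 + m * (1 / y) ^ 2)⁻¹ * (1 / y)) atTop (𝓝 0) := by
      simpa using t2.mul (tendsto_const_div_atTop 1)
    refine (tendsto_quadratic (tendsto_besselJ_sq_add_besselEuler hν) hA hB t2).congr' ?_
    filter_upwards [eventually_gt_atTop 0] with y hy
    have e4 : √y ^ 2 = y := Real.sq_sqrt hy.le
    have h0 : √y ≠ 0 := (Real.sqrt_pos.2 hy).ne'
    have hq : y ^ 2 + m ≠ 0 := by positivity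
    have e5 : (1 + m * (1 / y) ^ 2)⁻¹ = y ^ 2 / (y ^ 2 + m) := by field_simp
    have e6 : √y * besselJ ν y * (besselEuler ν y / √y) = besselJ ν y * besselEuler ν y := by
      field_simp
    have e8 : (√y * besselJ ν y) ^ 2 = y * besselJ ν y ^ 2 := by rw [mul_pow, e4]
    have e9 : (besselEuler ν y / √y) ^ 2 = besselEuler ν y ^ 2 / y := by rw [div_pow, e4]
    rw [e5, e6, e8, e9]
    field_simp
    ring
  have h := le_of_deriv_nonneg_of_tendsto hd (fun y _ => by positivity) hlim hx
  have : 0 ≤ x * (besselEuler ν x + besselJ ν x / 2) ^ 2 / (x ^ 2 + m) := by positivity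
  linarith

/-- In the Liouville variable `z = (x² - ν²)^{1/4} J_ν`, with `dτ = √(x² - ν²) dx / x`, Bessel's
equation is `z'' + (1 + r) z = 0` with `r = x² (x²/4 + ν²) / (x² - ν²)³` decreasing, so
`z² + z'²/(1 + r)` increases to its limit `2/π`. -/
lemma sqrt_mul_besselJ_sq_le {ν : ℝ} (hν : 0 < ν) {x : ℝ} (hx : ν < x) :
    √(x ^ 2 - ν ^ 2) * besselJ ν x ^ 2 ≤ 2 / Real.pi := by
  set T : ℝ → ℝ := fun x => (x ^ 2 - ν ^ 2) ^ 3 + x ^ 2 * (x ^ 2 / 4 + ν ^ 2) with hT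
  set A : ℝ → ℝ := fun x => (x ^ 2 - ν ^ 2) * besselEuler ν x + x ^ 2 * besselJ ν x / 2 with hA0
  have hQ : ∀ y : ℝ, ν < y → 0 < y ^ 2 - ν ^ 2 := fun y hy => by nlinarith
  have hTpos : ∀ y : ℝ, ν < y → 0 < T y := fun y hy => by
    have := hQ y hy
    have : 0 < y := hν.trans hy
    simp only [hT]
    positivity
  have hd : ∀ y : ℝ, ν < y → HasDerivAt
      (fun y => √(y ^ 2 - ν ^ 2) * besselJ ν y ^ 2 + √(y ^ 2 - ν ^ 2) * A y ^ 2 / T y)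
      (2 * y * (y ^ 4 / 4 + 5 / 2 * ν ^ 2 * y ^ 2 + ν ^ 4) * A y ^ 2 /
        (√(y ^ 2 - ν ^ 2) * T y ^ 2)) y := by
    intro y hy
    have hy0 : 0 < y := hν.trans hy
    have hJ := hasDerivAt_besselJ_euler hν.le hy0
    have hP := hasDerivAt_besselEuler hν.le hy0
    have h2 := (hasDerivAt_pow 2 y)
    have hs : HasDerivAt (fun y => √(y ^ 2 - ν ^ 2)) (y / √(y ^ 2 - ν ^ 2)) y := by
      refine ((h2.sub_const (ν ^ 2)).sqrt (hQ y hy).ne').congr_deriv ?_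
      field_simp
      push_cast
      ring
    have hA' : HasDerivAt A (2 * y * besselEuler ν y -
        (y ^ 2 - ν ^ 2) ^ 2 * besselJ ν y / y + y * besselJ ν y + y * besselEuler ν y / 2) y := by
      refine (((h2.sub_const (ν ^ 2)).mul hP).add ((h2.mul hJ).div_const 2)).congr_deriv ?_
      field_simp
      push_cast
      ring
    have hT' : HasDerivAt T (6 * y * (y ^ 2 - ν ^ 2) ^ 2 + y ^ 3 + 2 * y * ν ^ 2) y := by
      refine (((h2.sub_const (ν ^ 2)).pow 3).add
        (h2.mul ((h2.div_const 4).add_const (ν ^ 2)))).congr_deriv ?_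
      push_cast
      ring
    have h := (hs.mul (hJ.pow 2)).add ((hs.mul (hA'.pow 2)).div hT' (hTpos y hy).ne')
    refine h.congr_deriv ?_
    have hT0 := (hTpos y hy).ne'
    have hs0 : √(y ^ 2 - ν ^ 2) ≠ 0 := (Real.sqrt_pos.2 (hQ y hy)).ne'
    have hs2 : √(y ^ 2 - ν ^ 2) ^ 2 = y ^ 2 - ν ^ 2 := Real.sq_sqrt (hQ y hy).le
    simp only [Pi.mul_apply, Pi.pow_apply]
    field_simp
    rw [hs2]
    simp only [hT, hA0]
    push_cast
    ring
  have hlim : Tendsto (fun y => √(y ^ 2 - ν ^ 2) * besselJ ν y ^ 2 +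
      √(y ^ 2 - ν ^ 2) * A y ^ 2 / T y) atTop (𝓝 (2 / Real.pi)) := by
    have t1 : Tendsto (fun y : ℝ => 1 - (ν / y) ^ 2) atTop (𝓝 1) := by
      simpa using ((tendsto_const_div_atTop ν).pow 2).const_sub 1
    have t2 : Tendsto (fun y : ℝ => √(1 - (ν / y) ^ 2)) atTop (𝓝 1) := by
      simpa [Function.comp_def] using (Real.continuous_sqrt.tendsto 1).comp t1
    have t3 : Tendsto (fun y : ℝ => (1 - (ν / y) ^ 2) ^ 3 +
        (1 / 4 + (ν / y) ^ 2) * (1 / y) ^ 2) atTop (𝓝 1) := by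
      have h := (t1.pow 3).add ((((tendsto_const_div_atTop ν).pow 2).const_add (1 / 4)).mul
        ((tendsto_const_div_atTop 1).pow 2))
      norm_num at h ⊢
      exact h
    set K : ℝ → ℝ := fun y => √(1 - (ν / y) ^ 2) * ((1 - (ν / y) ^ 2) ^ 3 +
        (1 / 4 + (ν / y) ^ 2) * (1 / y) ^ 2)⁻¹ with hK
    have t4 : Tendsto K atTop (𝓝 1) := by
      have h := t2.mul (t3.inv₀ one_ne_zero)
      rwa [inv_one, mul_one] at h
    have hA : Tendsto (fun y : ℝ => √(1 - (ν / y) ^ 2) + K y * (1 / 2 / y) ^ 2) atTop (𝓝 1) := by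
      simpa using t2.add (t4.mul ((tendsto_const_div_atTop (1 / 2)).pow 2))
    have hB : Tendsto (fun y : ℝ => K y * (1 - (ν / y) ^ 2) * (1 / y)) atTop (𝓝 0) := by
      simpa using (t4.mul t1).mul (tendsto_const_div_atTop 1)
    have hC : Tendsto (fun y : ℝ => K y * (1 - (ν / y) ^ 2) ^ 2) atTop (𝓝 1) := by
      simpa using t4.mul (t1.pow 2)
    refine (tendsto_quadratic (tendsto_besselJ_sq_add_besselEuler hν) hA hB hC).congr' ?_
    filter_upwards [eventually_gt_atTop ν] with y hy
    have hy0 : 0 < y := hν.trans hy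
    have e4 : √y ^ 2 = y := Real.sq_sqrt hy0.le
    have h0 : √y ≠ 0 := (Real.sqrt_pos.2 hy0).ne'
    have hT0 := (hTpos y hy).ne'
    have e5 : √(1 - (ν / y) ^ 2) = √(y ^ 2 - ν ^ 2) / y := by
      rw [show 1 - (ν / y) ^ 2 = (y ^ 2 - ν ^ 2) / y ^ 2 by field_simp,
        Real.sqrt_div (hQ y hy).le, Real.sqrt_sq hy0.le]
    have e6 : √y * besselJ ν y * (besselEuler ν y / √y) = besselJ ν y * besselEuler ν y := by
      field_simp
    have e8 : (√y * besselJ ν y) ^ 2 = y * besselJ ν y ^ 2 := by rw [mul_pow, e4]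
    have e9 : (besselEuler ν y / √y) ^ 2 = besselEuler ν y ^ 2 / y := by rw [div_pow, e4]
    have e7 : ((1 - (ν / y) ^ 2) ^ 3 + (1 / 4 + (ν / y) ^ 2) * (1 / y) ^ 2)⁻¹ = y ^ 6 / T y := by
      rw [inv_eq_iff_eq_inv, inv_div]
      simp only [hT]
      field_simp
    simp only [hK]
    rw [e5, e6, e7, e8, e9]
    simp only [hA0]
    field_simp
    ring
  have h := le_of_deriv_nonneg_of_tendsto hd (fun y hy => by
    have : 0 < y := hν.trans hy
    positivity) hlim hx
  have : 0 ≤ √(x ^ 2 - ν ^ 2) * A x ^ 2 / T x :=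
    div_nonneg (by positivity) (hTpos x hx).le
  linarith

/-! ### Positivity and monotonicity before the first maximum -/

lemma besselEuler_add_one {ν : ℝ} (hν : 0 ≤ ν) {x : ℝ} (hx : 0 < x) :
    besselEuler (ν + 1) x = x * besselJ ν x - (ν + 1) * besselJ (ν + 1) x := by
  unfold besselEuler
  rw [show ν + 1 + 1 = ν + 2 by ring, besselJ_recurrence hν hx]
  field_simp
  ring

lemma continuousOn_besselJ {ν : ℝ} (hν : 0 ≤ ν) : ContinuousOn (besselJ ν) (Ioi 0) :=
  fun _ hx => (hasDerivAt_besselJ hν hx).continuousAt.continuousWithinAt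

lemma tendsto_besselJ_nhdsGT_zero {ν : ℝ} (hν : 0 < ν) :
    Tendsto (besselJ ν) (𝓝[>] 0) (𝓝 0) := by
  have h : Tendsto (fun x : ℝ => (x / 2) ^ ν * (Real.Gamma (ν + 1))⁻¹) (𝓝[>] 0) (𝓝 0) := by
    have hc : ContinuousAt (fun x : ℝ => (x / 2) ^ ν * (Real.Gamma (ν + 1))⁻¹) 0 :=
      (((continuous_id.div_const 2).rpow_const fun _ => Or.inr hν.le).mul
        continuous_const).continuousAt
    have := hc.tendsto
    simp only [zero_div, Real.zero_rpow hν.ne', zero_mul] at this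
    exact this.mono_left nhdsWithin_le_nhds
  refine squeeze_zero_norm' ?_ h
  filter_upwards [self_mem_nhdsWithin] with x hx
  exact abs_besselJ_le hν.le hx

lemma eventually_besselJ_pos {ν : ℝ} (hν : 0 ≤ ν) : ∀ᶠ x in 𝓝[>] (0 : ℝ), 0 < besselJ ν x := by
  have hc : ContinuousAt (fun x : ℝ => besselSeries ν (x ^ 2 / 4)) 0 :=
    (hasDerivAt_besselSeries_comp hν 0).continuousAt
  have h0 : 0 < besselSeries ν ((0 : ℝ) ^ 2 / 4) := by
    norm_num [besselSeries_zero]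
    exact Real.Gamma_pos_of_pos (by positivity)
  have := (hc.eventually (lt_mem_nhds h0)).filter_mono (nhdsWithin_le_nhds (s := Ioi 0))
  filter_upwards [this, self_mem_nhdsWithin] with x h1 h2
  rw [besselJ_eq]
  exact mul_pos (Real.rpow_pos_of_pos (half_pos h2) _) h1

/-- A function with positive derivative that starts from `0` is positive. -/
lemma pos_of_deriv_pos_of_tendsto_zero {F F' : ℝ → ℝ} {b : ℝ}
    (hd : ∀ y, 0 < y → HasDerivAt F (F' y) y) (hpos : ∀ y ∈ Ioo 0 b, 0 < F' y)
    (h0 : Tendsto F (𝓝[>] 0) (𝓝 0)) : ∀ y ∈ Ioc 0 b, 0 < F y := by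
  have hm : StrictMonoOn F (Ioc 0 b) := by
    refine strictMonoOn_of_deriv_pos (convex_Ioc 0 b)
      (fun y hy => (hd y hy.1).continuousAt.continuousWithinAt) fun y hy => ?_
    rw [interior_Ioc] at hy
    rw [(hd y hy.1).deriv]
    exact hpos y hy
  intro y hy
  have hy2 : 0 < y / 2 := half_pos hy.1
  have h1 : 0 ≤ F (y / 2) := by
    refine le_of_tendsto h0 ?_
    filter_upwards [Ioo_mem_nhdsGT hy2] with s hs
    exact (hm ⟨hs.1, by linarith [hs.2, hy.2]⟩ ⟨hy2, by linarith [hy.2]⟩ hs.2).le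
  exact h1.trans_lt (hm ⟨hy2, by linarith [hy.2]⟩ hy (by linarith))

/-- Positivity passes from `J_ν` to `J_{ν+1}`, because `(x^{ν+1} J_{ν+1})' = x^{ν+1} J_ν`. -/
lemma besselJ_add_one_pos {ν b : ℝ} (hν : 0 ≤ ν) (h : ∀ y ∈ Ioo 0 b, 0 < besselJ ν y) :
    ∀ y ∈ Ioc 0 b, 0 < besselJ (ν + 1) y := by
  have hlim : Tendsto (fun y : ℝ => y ^ (ν + 1) * besselJ (ν + 1) y) (𝓝[>] 0) (𝓝 0) := by
    have hc : ContinuousAt (fun x : ℝ => x ^ (ν + 1)) 0 :=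
      (Real.continuous_rpow_const (by linarith)).continuousAt
    have := (hc.tendsto.mono_left nhdsWithin_le_nhds).mul
      (tendsto_besselJ_nhdsGT_zero (ν := ν + 1) (by linarith))
    simpa using this
  have := pos_of_deriv_pos_of_tendsto_zero (b := b)
    (F' := fun y => y ^ (ν + 1) * besselJ ν y) (fun y hy => by
      refine ((Real.hasDerivAt_rpow_const (p := ν + 1) (Or.inl hy.ne')).mul
        (hasDerivAt_besselJ_add_one hν hy)).congr_deriv ?_
      rw [add_sub_cancel_right, Real.rpow_add_one hy.ne']
      field_simp
      ring) (fun y hy => mul_pos (Real.rpow_pos_of_pos hy.1 _) (h y hy)) hlim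
  intro y hy
  exact (mul_pos_iff_of_pos_left (Real.rpow_pos_of_pos hy.1 _)).1 (this y hy)

/-- As long as `J_ν` has been positive, `(x J_ν')² > (ν² - x² ν/(ν+1)) J_ν²`: the difference starts
from `0` and has derivative `2x² J_ν J_{ν+1} / (ν+1)`. -/
lemma lt_besselEuler_sq {ν b : ℝ} (hν : 0 < ν) (h : ∀ y ∈ Ioo 0 b, 0 < besselJ ν y) :
    ∀ y ∈ Ioc 0 b, (ν ^ 2 - y ^ 2 * ν / (ν + 1)) * besselJ ν y ^ 2 < besselEuler ν y ^ 2 := by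
  have t1 := tendsto_besselJ_nhdsGT_zero hν
  have tx : Tendsto (fun y : ℝ => y) (𝓝[>] 0) (𝓝 0) := tendsto_id.mono_left nhdsWithin_le_nhds
  have t2 : Tendsto (besselEuler ν) (𝓝[>] 0) (𝓝 0) := by
    have := (t1.const_mul ν).sub (tx.mul (tendsto_besselJ_nhdsGT_zero (ν := ν + 1) (by linarith)))
    simp only [mul_zero, sub_zero] at this
    exact this
  have hlim : Tendsto (fun y => besselEuler ν y ^ 2 -
      (ν ^ 2 - y ^ 2 * ν / (ν + 1)) * besselJ ν y ^ 2) (𝓝[>] 0) (𝓝 0) := by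
    have := (t2.pow 2).sub (((((tx.pow 2).mul_const ν).div_const (ν + 1)).const_sub (ν ^ 2)).mul
      (t1.pow 2))
    simpa using this
  have := pos_of_deriv_pos_of_tendsto_zero (b := b)
    (F' := fun y => 2 * y * besselJ ν y * (y * besselJ (ν + 1) y) / (ν + 1)) (fun y hy => by
      refine (((hasDerivAt_besselEuler hν.le hy).pow 2).sub
        ((((((hasDerivAt_pow 2 y).mul_const ν).div_const (ν + 1)).const_sub (ν ^ 2))).mul
          ((hasDerivAt_besselJ_euler hν.le hy).pow 2))).congr_deriv ?_
      have e : y * besselJ (ν + 1) y = ν * besselJ ν y - besselEuler ν y := by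
        unfold besselEuler; ring
      rw [e]
      simp only [Pi.pow_apply]
      push_cast
      field_simp
      ring) (fun y hy => by
      have h1 := h y hy
      have h2 := besselJ_add_one_pos hν.le h y ⟨hy.1, hy.2.le⟩
      have := hy.1
      positivity) hlim
  intro y hy
  have := this y hy
  linarith

/-- A continuous function that starts positive and ends nonpositive has a first zero. -/
lemma exists_first_zero {f : ℝ → ℝ} {a b : ℝ} (hab : a ≤ b) (hc : ContinuousOn f (Icc a b))
    (hfa : 0 < f a) (hfb : f b ≤ 0) :
    ∃ c ∈ Ioc a b, f c = 0 ∧ ∀ y ∈ Ico a c, 0 < f y := by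
  have hK : IsCompact (Icc a b ∩ f ⁻¹' Iic 0) :=
    isCompact_Icc.of_isClosed_subset (hc.preimage_isClosed_of_isClosed isClosed_Icc isClosed_Iic)
      inter_subset_left
  obtain ⟨c, ⟨hcab, hfc⟩, hmin⟩ := hK.exists_isLeast ⟨b, ⟨hab, le_rfl⟩, hfb⟩
  have hfc' : f c ≤ 0 := hfc
  have hac : a < c := lt_of_le_of_ne hcab.1 fun h => by
    rw [h] at hfa; exact absurd hfa (not_lt.2 hfc')
  refine ⟨c, ⟨hac, hcab.2⟩, ?_, fun y hy => ?_⟩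
  · obtain ⟨z, hz, hz0⟩ := intermediate_value_Icc' hac.le
      (hc.mono (Icc_subset_Icc_right hcab.2)) ⟨hfc', hfa.le⟩
    have : c ≤ z := hmin ⟨⟨hz.1, hz.2.trans hcab.2⟩, hz0.le⟩
    rwa [← le_antisymm hz.2 this]
  · by_contra hle
    exact absurd (hmin ⟨⟨hy.1, hy.2.le.trans hcab.2⟩, not_lt.1 hle⟩) (not_le.2 hy.2)

/-- `J_ν > 0` on `(0, √(ν(ν+1))]`: before a first zero there would be a critical point of `J_ν`,
which `lt_besselEuler_sq` excludes. -/
lemma besselJ_pos_of_sq_le {ν x : ℝ} (hν : 0 < ν) (hx : 0 < x) (hx2 : x ^ 2 ≤ ν * (ν + 1)) :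
    0 < besselJ ν x := by
  by_contra hneg
  obtain ⟨δ, hδ, hδ'⟩ := mem_nhdsGT_iff_exists_Ioo_subset.1 (eventually_besselJ_pos hν.le)
  have hδ0 : (0 : ℝ) < δ := hδ
  have hδx : δ ≤ x := by
    by_contra hlt
    exact hneg (hδ' ⟨hx, not_le.1 hlt⟩)
  obtain ⟨c, hc, hc0, hcpos⟩ := exists_first_zero (f := besselJ ν) (a := δ / 2) (b := x)
    (by linarith) ((continuousOn_besselJ hν.le).mono fun y hy => (half_pos hδ0).trans_le hy.1)
    (hδ' ⟨by linarith, by linarith⟩) (not_lt.1 hneg)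
  have hcpos0 : 0 < c := (half_pos hδ0).trans hc.1
  have hpos : ∀ y ∈ Ioo 0 c, 0 < besselJ ν y := fun y hy => by
    rcases lt_or_ge y δ with h | h
    · exact hδ' ⟨hy.1, h⟩
    · exact hcpos y ⟨by linarith, hy.2⟩
  have hcc : Tendsto (besselJ ν) (𝓝[<] c) (𝓝 0) := by
    rw [← hc0]
    exact (hasDerivAt_besselJ hν.le hcpos0).continuousAt.tendsto.mono_left nhdsWithin_le_nhds
  obtain ⟨ξ, hξ, hξ0⟩ := exists_hasDerivAt_eq_zero' hcpos0 (tendsto_besselJ_nhdsGT_zero hν) hcc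
    fun y hy => hasDerivAt_besselJ_euler hν.le hy.1
  have h := lt_besselEuler_sq hν hpos ξ ⟨hξ.1, hξ.2.le⟩
  have hE : besselEuler ν ξ = 0 := by
    rcases div_eq_zero_iff.1 hξ0 with h | h
    · exact h
    · exact absurd h hξ.1.ne'
  rw [hE] at h
  have hle : ξ ^ 2 * ν / (ν + 1) ≤ ν ^ 2 := by
    rw [div_le_iff₀ (by positivity)]
    have : ξ ^ 2 ≤ x ^ 2 := pow_le_pow_left₀ hξ.1.le (hξ.2.le.trans hc.2) 2
    nlinarith
  have : 0 ≤ (ν ^ 2 - ξ ^ 2 * ν / (ν + 1)) * besselJ ν ξ ^ 2 :=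
    mul_nonneg (by linarith) (sq_nonneg _)
  linarith

lemma besselEuler_pos_of_sq_le {ν x : ℝ} (hν : 0 < ν) (hx : 0 < x) (hx2 : x ^ 2 ≤ ν * (ν + 1)) :
    0 < besselEuler ν x := by
  have hpos : ∀ y ∈ Ioc 0 x, 0 < besselJ ν y := fun y hy =>
    besselJ_pos_of_sq_le hν hy.1 ((pow_le_pow_left₀ hy.1.le hy.2 2).trans hx2)
  have hne : ∀ y ∈ Ioc 0 x, besselEuler ν y ≠ 0 := fun y hy h0 => by
    have h := lt_besselEuler_sq hν (b := x) (fun y hy => hpos y ⟨hy.1, hy.2.le⟩) y hy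
    rw [h0] at h
    have hle : y ^ 2 * ν / (ν + 1) ≤ ν ^ 2 := by
      rw [div_le_iff₀ (by positivity)]
      have : y ^ 2 ≤ x ^ 2 := pow_le_pow_left₀ hy.1.le hy.2 2
      nlinarith
    have : 0 ≤ (ν ^ 2 - y ^ 2 * ν / (ν + 1)) * besselJ ν y ^ 2 :=
      mul_nonneg (by linarith) (sq_nonneg _)
    linarith
  by_contra hle
  have hlt : besselEuler ν x < 0 := lt_of_le_of_ne (not_lt.1 hle) (hne x ⟨hx, le_rfl⟩)
  have hc : ContinuousOn (besselEuler ν) (Ioi 0) := fun y hy =>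
    (hasDerivAt_besselEuler hν.le hy).continuousAt.continuousWithinAt
  -- `J_ν` would be decreasing from its limit `0`, yet positive
  have hall : ∀ y ∈ Ioo 0 x, besselEuler ν y < 0 := fun y hy => by
    by_contra hy0
    obtain ⟨z, hz, hz0⟩ := intermediate_value_Icc' hy.2.le
      (hc.mono fun s hs => hy.1.trans_le hs.1) ⟨hlt.le, not_lt.1 hy0⟩
    exact hne z ⟨hy.1.trans_le hz.1, hz.2⟩ hz0
  have h := pos_of_deriv_pos_of_tendsto_zero (F := fun y => -besselJ ν y) (b := x)
    (fun y hy => (hasDerivAt_besselJ_euler hν.le hy).neg)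
    (fun y hy => by
      have := div_neg_of_neg_of_pos (hall y hy) hy.1
      linarith) (by simpa using (tendsto_besselJ_nhdsGT_zero hν).neg) x ⟨hx, le_rfl⟩
  have := hpos x ⟨hx, le_rfl⟩
  linarith

/-- `x ↦ x^{1/3} J_ν(x)` is increasing at `x`, and positive, for moderate `x`. The logarithmic
derivatives `v_ν = x J_ν'/J_ν` satisfy `v_ν = ν - x²/(ν + 1 + v_{ν+1})`, and `v_{ν+1}` is bounded
below by `lt_besselEuler_sq`. -/
lemma besselJ_pos_and_increasing {ν x : ℝ} (hν : 0 ≤ ν) (hx : 0 < x)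
    (h1 : x ^ 2 * (ν + 2) ≤ (ν + 1 / 3) * (ν + 1) * (ν + 11 / 3))
    (h2 : x ^ 2 ≤ (ν + 1) * (ν + 2)) :
    0 < besselJ ν x ∧ 0 ≤ besselEuler ν x + besselJ ν x / 3 := by
  have h2' : x ^ 2 ≤ (ν + 1) * (ν + 1 + 1) := by linarith
  have hJ := besselJ_pos_of_sq_le (ν := ν + 1) (by linarith) hx h2'
  have hP := besselEuler_pos_of_sq_le (ν := ν + 1) (by linarith) hx h2'
  have hG := lt_besselEuler_sq (ν := ν + 1) (b := x) (by linarith) (fun y hy =>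
    besselJ_pos_of_sq_le (by linarith) hy.1
      ((pow_le_pow_left₀ hy.1.le hy.2.le 2).trans h2')) x ⟨hx, le_rfl⟩
  have hE := besselEuler_add_one hν hx
  set j := besselJ (ν + 1) x
  set p := besselEuler (ν + 1) x
  have hxJ : x * besselJ ν x = (ν + 1) * j + p := by linarith
  have hJ0 : 0 < besselJ ν x := by
    have : 0 < x * besselJ ν x := by rw [hxJ]; positivity
    exact (mul_pos_iff_of_pos_left hx).1 this
  refine ⟨hJ0, ?_⟩
  have key : x ^ 2 * j ≤ (ν + 1 / 3) * ((ν + 1) * j + p) := by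
    rcases le_total (x ^ 2) ((ν + 1 / 3) * (ν + 1)) with h | h
    · nlinarith [mul_le_mul_of_nonneg_right h hJ.le]
    · have hsq : ((x ^ 2 - (ν + 1 / 3) * (ν + 1)) * j) ^ 2 ≤ ((ν + 1 / 3) * p) ^ 2 := by
        have hs : (x ^ 2 - (ν + 1 / 3) * (ν + 1)) ^ 2 ≤
            (ν + 1 / 3) ^ 2 * ((ν + 1) ^ 2 - x ^ 2 * (ν + 1) / (ν + 1 + 1)) := by
          have e : (ν + 1 / 3) ^ 2 * ((ν + 1) ^ 2 - x ^ 2 * (ν + 1) / (ν + 1 + 1)) -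
              (x ^ 2 - (ν + 1 / 3) * (ν + 1)) ^ 2 = x ^ 2 * ((ν + 1 / 3) * (ν + 1) * (ν + 11 / 3) -
                x ^ 2 * (ν + 2)) / (ν + 2) := by
            have : ν + 2 ≠ 0 := by positivity
            have : ν + 1 + 1 ≠ 0 := by positivity
            field_simp
            ring
          have : 0 ≤ x ^ 2 * ((ν + 1 / 3) * (ν + 1) * (ν + 11 / 3) -
                x ^ 2 * (ν + 2)) / (ν + 2) :=
            div_nonneg (mul_nonneg (sq_nonneg _) (by linarith)) (by linarith)
          linarith
        calc _ = (x ^ 2 - (ν + 1 / 3) * (ν + 1)) ^ 2 * j ^ 2 := by ring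
          _ ≤ (ν + 1 / 3) ^ 2 * ((ν + 1) ^ 2 - x ^ 2 * (ν + 1) / (ν + 1 + 1)) * j ^ 2 :=
              mul_le_mul_of_nonneg_right hs (sq_nonneg _)
          _ = (ν + 1 / 3) ^ 2 * (((ν + 1) ^ 2 - x ^ 2 * (ν + 1) / (ν + 1 + 1)) * j ^ 2) := by ring
          _ ≤ (ν + 1 / 3) ^ 2 * p ^ 2 := mul_le_mul_of_nonneg_left hG.le (sq_nonneg _)
          _ = _ := by ring
      have := abs_le_of_sq_le_sq hsq (by positivity)
      have := (abs_le.1 this).2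
      linarith
  have e : x * (besselEuler ν x + besselJ ν x / 3) =
      (ν + 1 / 3) * ((ν + 1) * j + p) - x ^ 2 * j := by
    rw [← hxJ]
    change x * (ν * besselJ ν x - x * j + besselJ ν x / 3) = _
    ring
  exact (mul_nonneg_iff_of_pos_left hx).1 (by rw [e]; linarith)

/-- A Riccati comparison past the turning point: `g = α - (x² - a²)²/(4x²)` is a subsolution of
`x g' = ν² - x² - g²`, the equation satisfied by `x J_ν'/J_ν`. -/
lemma besselJ_pos_of_riccati {ν a b α : ℝ} (hν : 0 < ν) (ha : 0 < a) (hα : 2 ≤ α)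
    (haα : α ^ 2 = ν ^ 2 - a ^ 2)
    (hb : ∀ y ∈ Icc a b, (y ^ 2 - a ^ 2) ^ 2 ≤ 4 * α * y ^ 2) :
    ∀ y ∈ Icc a b, 0 < besselJ ν y ∧ 0 ≤ besselEuler ν y := by
  have ha2 : a ^ 2 ≤ ν * (ν + 1) := by nlinarith
  have hJa := besselJ_pos_of_sq_le hν ha ha2
  have hPa : α * besselJ ν a ≤ besselEuler ν a := by
    have hG := lt_besselEuler_sq (ν := ν) (b := a) hν (fun y hy =>
      besselJ_pos_of_sq_le hν hy.1 ((pow_le_pow_left₀ hy.1.le hy.2.le 2).trans ha2)) a ⟨ha, le_rfl⟩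
    refine (abs_le_of_sq_le_sq' ?_ (besselEuler_pos_of_sq_le hν ha ha2).le).2
    rw [mul_pow, haα]
    refine le_trans (mul_le_mul_of_nonneg_right ?_ (sq_nonneg _)) hG.le
    have : a ^ 2 * ν / (ν + 1) ≤ a ^ 2 := by
      rw [div_le_iff₀ (by positivity)]; nlinarith [sq_nonneg a]
    linarith
  set g : ℝ → ℝ := fun y => α - (y ^ 2 - a ^ 2) ^ 2 / (4 * y ^ 2) with hg
  -- the integrating factor of the comparison, with `y φ' = g φ`
  set φ : ℝ → ℝ := fun y =>
    Real.exp ((α + a ^ 2 / 2) * Real.log y - y ^ 2 / 8 + a ^ 4 / 8 * (y ^ 2)⁻¹) with hφ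
  set K : ℝ → ℝ := fun y => φ y * (besselEuler ν y - g y * besselJ ν y) with hK
  set δ : ℝ → ℝ := fun y => (y ^ 2 - a ^ 2) ^ 2 / (4 * y ^ 2) with hδ
  have hKd : ∀ y, 0 < y → HasDerivAt K
      (φ y * besselJ ν y * (δ y * (2 * α - 2 - δ y)) / y) y := by
    intro y hy
    have hyy : y ≠ 0 := hy.ne'
    have h2 := hasDerivAt_pow 2 y
    have hφd : HasDerivAt φ (φ y * (g y / y)) y := by
      refine ((((((Real.hasDerivAt_log hyy).const_mul (α + a ^ 2 / 2)).sub
        (h2.div_const 8)).add ((h2.inv (pow_ne_zero 2 hyy)).const_mul (a ^ 4 / 8)))).exp).congr_deriv ?_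
      change φ y * _ = _
      congr 1
      simp only [hg]
      push_cast
      field_simp
      ring
    have hgd : HasDerivAt g (-((y ^ 2 - a ^ 2) * (y ^ 2 + a ^ 2) / (2 * y ^ 3))) y := by
      refine (((((h2.sub_const (a ^ 2)).pow 2).div (h2.const_mul 4)
        (by positivity))).const_sub α).congr_deriv ?_
      simp only [Pi.pow_apply]
      push_cast
      field_simp
      ring
    refine (hφd.mul ((hasDerivAt_besselEuler hν.le hy).sub
      (hgd.mul (hasDerivAt_besselJ_euler hν.le hy)))).congr_deriv ?_
    have e : ν ^ 2 = α ^ 2 + a ^ 2 := by linarith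
    rw [e]
    simp only [hg, hδ, Pi.sub_apply, Pi.mul_apply]
    field_simp
    ring
  have hδb : ∀ y ∈ Icc a b, 0 ≤ δ y ∧ δ y ≤ α := fun y hy => by
    have : 0 < y := ha.trans_le hy.1
    refine ⟨by positivity, ?_⟩
    simp only [hδ]
    rw [div_le_iff₀ (by positivity)]
    linarith [hb y hy]
  -- as long as `J_ν` stays positive, `x J_ν' ≥ g J_ν ≥ 0`
  have hmain : ∀ c ∈ Icc a b, (∀ y ∈ Ico a c, 0 < besselJ ν y) →
      0 ≤ K c ∧ besselJ ν a ≤ besselJ ν c := by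
    intro c hc hpos
    have hKm : MonotoneOn K (Icc a c) := by
      refine monotoneOn_of_deriv_nonneg (convex_Icc a c)
        (fun y hy => (hKd y (ha.trans_le hy.1)).continuousAt.continuousWithinAt)
        (fun y hy => ?_) fun y hy => ?_ <;> rw [interior_Icc] at hy
      · exact (hKd y (ha.trans hy.1)).differentiableAt.differentiableWithinAt
      · rw [(hKd y (ha.trans hy.1)).deriv]
        have hy0 := ha.trans hy.1
        have h1 := hδb y ⟨hy.1.le, hy.2.le.trans hc.2⟩
        have h2 := hpos y ⟨hy.1.le, hy.2⟩
        have h3 : 0 < φ y := Real.exp_pos _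
        have h4 : 0 ≤ 2 * α - 2 - δ y := by linarith
        exact div_nonneg (mul_nonneg (by positivity) (mul_nonneg h1.1 h4)) hy0.le
    have hKa : 0 ≤ K a := by
      simp only [hK, hg]
      refine mul_nonneg (Real.exp_pos _).le ?_
      norm_num
      linarith
    have hKnn : ∀ y ∈ Icc a c, 0 ≤ K y := fun y hy =>
      hKa.trans (hKm ⟨le_rfl, hc.1⟩ hy hy.1)
    refine ⟨hKnn c ⟨hc.1, le_rfl⟩, ?_⟩
    have hJm : MonotoneOn (besselJ ν) (Icc a c) := by
      refine monotoneOn_of_deriv_nonneg (convex_Icc a c)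
        (fun y hy => (hasDerivAt_besselJ hν.le
          (ha.trans_le hy.1)).continuousAt.continuousWithinAt)
        (fun y hy => ?_) fun y hy => ?_ <;> rw [interior_Icc] at hy
      · exact (hasDerivAt_besselJ hν.le
          (ha.trans hy.1)).differentiableAt.differentiableWithinAt
      · rw [(hasDerivAt_besselJ_euler hν.le (ha.trans hy.1)).deriv]
        have h1 := hδb y ⟨hy.1.le, hy.2.le.trans hc.2⟩
        have h2 := hpos y ⟨hy.1.le, hy.2⟩
        have h3 := (mul_nonneg_iff_of_pos_left (Real.exp_pos _)).1 (hKnn y ⟨hy.1.le, hy.2.le⟩)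
        have h4 : 0 ≤ g y := by
          have : g y = α - δ y := rfl
          linarith
        have := mul_nonneg h4 h2.le
        exact div_nonneg (by linarith) (ha.trans hy.1).le
    exact hJm ⟨le_rfl, hc.1⟩ ⟨hc.1, le_rfl⟩ hc.1
  have hpos : ∀ y ∈ Icc a b, 0 < besselJ ν y := by
    intro y hy
    by_contra hneg
    obtain ⟨c, hc, hc0, hcpos⟩ := exists_first_zero (f := besselJ ν) hy.1
      ((continuousOn_besselJ hν.le).mono fun s hs => ha.trans_le hs.1) hJa (not_lt.1 hneg)
    have := (hmain c ⟨hc.1.le, hc.2.trans hy.2⟩ hcpos).2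
    rw [hc0] at this
    linarith
  intro y hy
  refine ⟨hpos y hy, ?_⟩
  have h3 := (mul_nonneg_iff_of_pos_left (Real.exp_pos _)).1
    (hmain y hy fun s hs => hpos s ⟨hs.1, hs.2.le.trans hy.2⟩).1
  have h4 : 0 ≤ g y := by
    have : g y = α - δ y := rfl
    linarith [(hδb y hy).2]
  have := mul_nonneg h4 (hpos y hy).le
  linarith

/-! ### Orders close to zero -/

/-- The value to which `sup |x^{1/3} J_ν(x)|` is bounded; the supremum is `0.78574687…`. -/
noncomputable def landauUpper : ℝ := 0.78574695

lemma eulerMascheroniConstant_lt : Real.eulerMascheroniConstant < 0.5928 := by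
  refine (Real.eulerMascheroniConstant_lt_eulerMascheroniSeq' 32).trans ?_
  rw [Real.eulerMascheroniSeq', if_neg (by norm_num)]
  have h : Real.log (32 : ℕ) = 5 * Real.log 2 := by
    rw [show ((32 : ℕ) : ℝ) = 2 ^ 5 by norm_num, Real.log_pow]; norm_num
  have hh : (harmonic 32 : ℝ) < 4.0585 := by
    have : harmonic 32 < 4.0585 := by norm_num [harmonic, Finset.sum_range_succ]
    have h2 : ((harmonic 32 : ℚ) : ℝ) < ((4.0585 : ℚ) : ℝ) := by exact_mod_cast this
    exact h2.trans_eq (by norm_num)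
  rw [h]
  linarith [Real.log_two_gt_d9]

/-- The tangent of the convex function `log Γ` at `2`. -/
lemma exp_le_Gamma_add_two {ν : ℝ} (hν : 0 ≤ ν) :
    Real.exp ((1 - Real.eulerMascheroniConstant) * ν) ≤ Real.Gamma (ν + 2) := by
  rcases hν.eq_or_lt with rfl | hν
  · simp
  have hd : HasDerivAt (Real.log ∘ Real.Gamma) (1 - Real.eulerMascheroniConstant) 2 := by
    have h := Real.hasDerivAt_Gamma_nat 1
    norm_num at h
    have h2 : Real.Gamma 2 ≠ 0 := by rw [Real.Gamma_two]; exact one_ne_zero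
    refine ((Real.hasDerivAt_log h2).comp 2 h).congr_deriv ?_
    rw [Real.Gamma_two]
    ring
  have h := Real.convexOn_log_Gamma.le_slope_of_hasDerivAt (x := 2) (y := ν + 2) (by simp)
    (by simp; linarith) (by linarith) hd
  rw [slope_def_field, Function.comp, Function.comp, Real.Gamma_two, Real.log_one, sub_zero,
    add_sub_cancel_right, le_div_iff₀ hν] at h
  rw [← Real.le_log_iff_exp_le (Real.Gamma_pos_of_pos (by linarith))]
  exact h

lemma besselSeries_pos {ν z : ℝ} (hν : 0 ≤ ν) (hz : 0 ≤ z) (hz1 : z < 1) :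
    0 < besselSeries ν z := by
  obtain ⟨hanti, hlim⟩ := besselSeries_alternating hν hz hz1.le
  have h := hanti.alternating_series_le_tendsto hlim 1
  refine lt_of_lt_of_le ?_ h
  have hG : 0 < Real.Gamma (ν + 1) := Real.Gamma_pos_of_pos (by linarith)
  have hG2 : Real.Gamma (ν + 1 + 1) = (ν + 1) * Real.Gamma (ν + 1) :=
    Real.Gamma_add_one (by positivity)
  norm_num [Finset.sum_range_succ, hG2]
  rw [div_lt_iff₀ (by positivity)]
  field_simp
  linarith

/-- Five terms of the alternating series bound `Γ(ν + 2) J_ν(x) / (x/2)^ν` by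
`J_0`-like partial sums plus `ν`. -/
lemma Gamma_mul_besselSeries_le {ν z : ℝ} (hν : 0 ≤ ν) (hz : 0 ≤ z) (hz1 : z ≤ 1) :
    Real.Gamma (ν + 2) * besselSeries ν z ≤
      1 - z + z ^ 2 / 4 - z ^ 3 / 36 + z ^ 4 / 576 + ν := by
  obtain ⟨hanti, hlim⟩ := besselSeries_alternating hν hz hz1
  have h := hanti.tendsto_le_alternating_series hlim 2
  have hG : 0 < Real.Gamma (ν + 1) := Real.Gamma_pos_of_pos (by linarith)
  have hG2 : Real.Gamma (ν + 2) = (ν + 1) * Real.Gamma (ν + 1) := by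
    rw [← Real.Gamma_add_one (by positivity)]; ring_nf
  have hG3 : Real.Gamma (ν + 2 + 1) = (ν + 2) * ((ν + 1) * Real.Gamma (ν + 1)) := by
    rw [← hG2, ← Real.Gamma_add_one (by positivity)]
  have hG4 : Real.Gamma (ν + 3 + 1) = (ν + 3) * ((ν + 2) * ((ν + 1) * Real.Gamma (ν + 1))) := by
    rw [← hG3, show ν + 2 + 1 = ν + 3 by ring, ← Real.Gamma_add_one (by positivity)]
  have hG5 : Real.Gamma (ν + 4 + 1) =
      (ν + 4) * ((ν + 3) * ((ν + 2) * ((ν + 1) * Real.Gamma (ν + 1)))) := by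
    rw [← hG4, show ν + 3 + 1 = ν + 4 by ring, ← Real.Gamma_add_one (by positivity)]
  have hG2' : Real.Gamma (ν + 1 + 1) = (ν + 1) * Real.Gamma (ν + 1) :=
    Real.Gamma_add_one (by positivity)
  simp only [Finset.sum_range_succ, Finset.sum_range_zero, Nat.factorial] at h
  push_cast at h
  norm_num [hG2', hG3, hG4, hG5] at h
  rw [hG2]
  refine (mul_le_mul_of_nonneg_left h (by positivity)).trans ?_
  have e : (ν + 1) * Real.Gamma (ν + 1) * (1 / Real.Gamma (ν + 1) +
      -(z / ((ν + 1) * Real.Gamma (ν + 1))) +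
      z ^ 2 / (2 * ((ν + 2) * ((ν + 1) * Real.Gamma (ν + 1)))) +
      -(z ^ 3 / (6 * ((ν + 3) * ((ν + 2) * ((ν + 1) * Real.Gamma (ν + 1)))))) +
      z ^ 4 / (24 * ((ν + 4) * ((ν + 3) * ((ν + 2) * ((ν + 1) * Real.Gamma (ν + 1))))))) =
      1 + ν - z + z ^ 2 / (2 * (ν + 2)) - z ^ 3 / (6 * (ν + 2) * (ν + 3)) +
        z ^ 4 / (24 * (ν + 2) * (ν + 3) * (ν + 4)) := by
    field_simp
    ring
  have h4 : z ^ 4 / (24 * (ν + 2) * (ν + 3) * (ν + 4)) ≤ z ^ 4 / 576 := by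
    refine div_le_div_of_nonneg_left (by positivity) (by norm_num) ?_
    have h23 : 6 ≤ (ν + 2) * (ν + 3) := by nlinarith
    nlinarith
  have h3 : z ^ 2 / (2 * (ν + 2)) - z ^ 3 / (6 * (ν + 2) * (ν + 3)) ≤ z ^ 2 / 4 - z ^ 3 / 36 := by
    have e3 : z ^ 2 / 4 - z ^ 3 / 36 - (z ^ 2 / (2 * (ν + 2)) - z ^ 3 / (6 * (ν + 2) * (ν + 3))) =
        z ^ 2 * ν * (9 * (ν + 3) - z * (ν + 5)) / (36 * (ν + 2) * (ν + 3)) := by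
      field_simp
      ring
    have : 0 ≤ z ^ 2 * ν * (9 * (ν + 3) - z * (ν + 5)) / (36 * (ν + 2) * (ν + 3)) := by
      refine div_nonneg (mul_nonneg (by positivity) ?_) (by positivity)
      nlinarith
    linarith
  simp only [one_div] at e ⊢
  rw [e]
  linarith

/-- The maximum of `x^{1/3} J_0(x)` is near `x^{1/3} = 0.922`; Bernoulli's inequality
`6 r ≤ 5 + r⁶` reduces the bound to a quintic in `r⁶`, where `r = t / 0.922`. -/
lemma mul_partialSum_le {t : ℝ} (ht0 : 0 < t) (ht : t ≤ 1.0312) :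
    t * (1 - t ^ 6 / 4 + (t ^ 6 / 4) ^ 2 / 4 - (t ^ 6 / 4) ^ 3 / 36 + (t ^ 6 / 4) ^ 4 / 576)
      ≤ landauUpper := by
  obtain ⟨r, rfl⟩ : ∃ r, t = 0.922 * r := ⟨t / 0.922, by field_simp⟩
  have hr0 : 0 < r := by linarith
  have hr1 : r ≤ 1.11845 := by linarith
  have hbern : 6 * r ≤ 5 + r ^ 6 := by
    have := one_add_mul_le_pow (a := r - 1) (by linarith) 6
    norm_num at this
    linarith
  have hh : r ^ 6 ≤ 2 := by
    have := pow_le_pow_left₀ hr0.le hr1 6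
    norm_num at this
    linarith
  have hw0 : 0 ≤ r ^ 6 := by positivity
  rw [show (0.922 * r) ^ 6 / 4 = 0.922 ^ 6 / 4 * r ^ 6 by ring]
  generalize hw : r ^ 6 = w at *
  obtain ⟨h, rfl⟩ : ∃ h, w = 1 + h := ⟨w - 1, by ring⟩
  set z := (0.922 : ℝ) ^ 6 / 4 * (1 + h) with hz
  have hz0 : 0 ≤ z := by positivity
  have hz1 : z ≤ 1 := by rw [hz]; norm_num; linarith
  have hS : 0 ≤ 1 - z + z ^ 2 / 4 - z ^ 3 / 36 + z ^ 4 / 576 := by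
    have : z ^ 3 ≤ z ^ 2 := pow_le_pow_of_le_one hz0 hz1 (by norm_num)
    have := pow_nonneg hz0 4
    nlinarith [sq_nonneg z]
  have h1 : 0.922 * r * (1 - z + z ^ 2 / 4 - z ^ 3 / 36 + z ^ 4 / 576) ≤
      0.922 * ((5 + (1 + h)) / 6) * (1 - z + z ^ 2 / 4 - z ^ 3 / 36 + z ^ 4 / 576) :=
    mul_le_mul_of_nonneg_right (by linarith) hS
  refine h1.trans ?_
  have hm1 : -1 ≤ h := by linarith
  have hp1 : h ≤ 1 := by linarith
  have h3 : h ^ 3 ≤ h ^ 2 := by nlinarith [sq_nonneg h]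
  have h5 : h ^ 5 ≤ h ^ 2 := by nlinarith [sq_nonneg h, sq_nonneg (h ^ 2), sq_nonneg (h * (1 - h))]
  have h4 : 0 ≤ h ^ 4 := by positivity
  rw [hz, landauUpper]
  norm_num
  nlinarith [sq_nonneg (h + 0.0015), sq_nonneg h]

/-- The gap left by the previous bound away from the maximum. -/
lemma partialSum_gap {e : ℝ} (he1 : -0.046 ≤ e) (he2 : e ≤ 0.0312) :
    0.0199 + 0.545 * e + 3.6 * e ^ 2 ≤ landauUpper - (1 + e) * (1 - (1 + e) ^ 6 / 4 +
      ((1 + e) ^ 6 / 4) ^ 2 / 4 - ((1 + e) ^ 6 / 4) ^ 3 / 36 + ((1 + e) ^ 6 / 4) ^ 4 / 576) := by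
  set t := 1 + e with ht
  have ht0 : 0 < t := by linarith
  have hz0 : 0 ≤ t ^ 6 / 4 := by positivity
  have hz1 : t ^ 6 / 4 ≤ 1 := by
    have := pow_le_pow_left₀ ht0.le (show t ≤ 1.0312 by linarith) 6
    norm_num at this
    linarith
  have hdrop : (t ^ 6 / 4) ^ 4 / 576 ≤ (t ^ 6 / 4) ^ 3 / 36 := by
    have : (t ^ 6 / 4) ^ 4 ≤ (t ^ 6 / 4) ^ 3 := pow_le_pow_of_le_one hz0 hz1 (by norm_num)
    have := pow_nonneg hz0 3
    linarith
  have h1 : t * (1 - t ^ 6 / 4 + (t ^ 6 / 4) ^ 2 / 4 - (t ^ 6 / 4) ^ 3 / 36 +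
      (t ^ 6 / 4) ^ 4 / 576) ≤ t * (1 - t ^ 6 / 4 + (t ^ 6 / 4) ^ 2 / 4) :=
    mul_le_mul_of_nonneg_left (by linarith) ht0.le
  have habs : |e| ≤ 0.046 := abs_le.2 ⟨he1, by linarith⟩
  have horner : ∀ a p B : ℝ, |p| ≤ B → |a + e * p| ≤ |a| + 0.046 * B := fun a p B hp =>
    (abs_add_le _ _).trans (by
      rw [abs_mul]
      have := mul_le_mul habs hp (abs_nonneg _) (by norm_num)
      linarith)
  have h7 : 1 + 7 * e + 21 * e ^ 2 + 35 * e ^ 3 ≤ t ^ 7 := by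
    have : t ^ 7 - (1 + 7 * e + 21 * e ^ 2 + 35 * e ^ 3) =
        e ^ 4 * (35 + 21 * e + e ^ 2 * (7 + e)) := by rw [ht]; ring
    have : 0 ≤ e ^ 4 * (35 + 21 * e + e ^ 2 * (7 + e)) := by
      have h7e : 0 ≤ 7 + e := by linarith
      have : 0 ≤ e ^ 2 * (7 + e) := mul_nonneg (sq_nonneg e) h7e
      exact mul_nonneg (by positivity) (by linarith)
    linarith
  have h13 : t ^ 13 ≤ 1 + 13 * e + 78 * e ^ 2 + 286 * e ^ 3 + 800 * e ^ 4 := by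
    have hq := horner 715 _ _ <| horner 1287 _ _ <| horner 1716 _ _ <| horner 1716 _ _ <|
      horner 1287 _ _ <| horner 715 _ _ <| horner 286 _ _ <| horner 78 _ _ <|
      horner 13 1 1 (by norm_num)
    norm_num at hq
    have hq' := (abs_le.1 hq).2
    have e13 : t ^ 13 = 1 + 13 * e + 78 * e ^ 2 + 286 * e ^ 3 + e ^ 4 * (715 + e * (1287 + e *
      (1716 + e * (1716 + e * (1287 + e * (715 + e * (286 + e * (78 + e * (13 + e))))))))) := by
      rw [ht]; ring
    have h4 : 0 ≤ e ^ 4 := by positivity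
    rw [e13]
    nlinarith [mul_le_mul_of_nonneg_left hq' h4]
  have e1 : t * (1 - t ^ 6 / 4 + (t ^ 6 / 4) ^ 2 / 4) = t - t ^ 7 / 4 + t ^ 13 / 64 := by ring
  have e3 : -0.046 * e ^ 2 ≤ e ^ 3 := by nlinarith [sq_nonneg e]
  have e4 : e ^ 4 ≤ 0.0022 * e ^ 2 := by nlinarith [sq_nonneg e]
  have : landauUpper = 0.78574695 := rfl
  rw [e1] at h1
  nlinarith [sq_nonneg (e + 0.002)]

/-- The bound near the origin, for every order: with `t = x^{1/3}` and
`lam = 1 - γ - log (x/2)`, one has `x^{1/3} J_ν(x) ≤ t (S + ν) e^{-lam ν}`, where `S` is a partial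
sum of `J_0(x)`. -/
lemma abs_mul_besselJ_le_of_le {ν t : ℝ} (hν : 0 < ν) (ht0 : 0 < t) (ht : t ≤ 1.0312) :
    |t * besselJ ν (t ^ 3)| ≤ landauUpper := by
  set z := t ^ 6 / 4 with hz
  have hz0 : 0 ≤ z := by positivity
  have hz1 : z < 1 := by
    have := pow_le_pow_left₀ ht0.le ht 6
    norm_num at this
    rw [hz]; linarith
  have hx : 0 < t ^ 3 / 2 := by positivity
  have hJ : besselJ ν (t ^ 3) = (t ^ 3 / 2) ^ ν * besselSeries ν z := by
    rw [besselJ_eq, hz]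
    ring_nf
  have hp : 0 < (t ^ 3 / 2) ^ ν := Real.rpow_pos_of_pos hx _
  have hS := besselSeries_pos hν.le hz0 hz1
  rw [hJ, abs_of_pos (by positivity)]
  set S := 1 - z + z ^ 2 / 4 - z ^ 3 / 36 + z ^ 4 / 576 with hSdef
  have hGS := Gamma_mul_besselSeries_le hν.le hz0 hz1.le
  rw [← hSdef] at hGS
  have hGe := exp_le_Gamma_add_two hν.le
  have hγ := eulerMascheroniConstant_lt
  have hG : 0 < Real.Gamma (ν + 2) := Real.Gamma_pos_of_pos (by linarith)
  -- `log t ≤ t - 1`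
  have hlog : Real.log (t ^ 3 / 2) ≤ 3 * (t - 1) - 0.6931 := by
    rw [Real.log_div (by positivity) (by norm_num), Real.log_pow]
    have := Real.log_le_sub_one_of_pos ht0
    push_cast
    linarith [Real.log_two_gt_d9]
  set lam := 1.1003 - 3 * (t - 1) with hlam
  have hlam0 : 0 < lam := by rw [hlam]; linarith
  have hexp : (t ^ 3 / 2) ^ ν * Real.exp (lam * ν) ≤ Real.Gamma (ν + 2) := by
    refine le_trans ?_ hGe
    rw [Real.rpow_def_of_pos hx, ← Real.exp_add]
    refine Real.exp_le_exp.2 ?_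
    have : Real.log (t ^ 3 / 2) + lam ≤ 1 - Real.eulerMascheroniConstant := by
      rw [hlam]; linarith
    nlinarith
  have hSν : 0 < S + ν := lt_of_lt_of_le (by positivity) hGS
  have hquad : t * (S + ν) ≤ landauUpper * (1 + lam * ν + (lam * ν) ^ 2 / 2) := by
    have hc : landauUpper = 0.78574695 := rfl
    have hc0 : 0 < landauUpper := by rw [hc]; norm_num
    have hg : t * S ≤ landauUpper := mul_partialSum_le ht0 ht
    rcases le_total t 0.955 with h | h
    · have : t ≤ landauUpper * lam := by
        rw [hc, hlam]; linarith
      nlinarith [mul_le_mul_of_nonneg_right this hν.le, sq_nonneg (lam * ν)]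
    · have hgap := partialSum_gap (e := t - 1) (by linarith) (by linarith)
      rw [add_sub_cancel, ← hz, ← hSdef] at hgap
      have hdisc : (t - landauUpper * lam) ^ 2 ≤
          2 * landauUpper * lam ^ 2 * (landauUpper - t * S) := by
        refine le_trans ?_ (mul_le_mul_of_nonneg_left hgap (by positivity))
        rw [hc, hlam]
        obtain ⟨e, rfl⟩ : ∃ e, t = 1 + e := ⟨t - 1, by ring⟩
        have h1 : -0.045 ≤ e := by linarith
        have h2 : e ≤ 0.0312 := by linarith
        rw [add_sub_cancel_left]
        nlinarith [mul_nonneg (sub_nonneg.2 h1) (sub_nonneg.2 h2), sq_nonneg e,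
          mul_nonneg (mul_nonneg (sub_nonneg.2 h1) (sub_nonneg.2 h2)) (sq_nonneg e)]
      have ha : 0 < 2 * landauUpper * lam ^ 2 := by positivity
      have e : 2 * landauUpper * lam ^ 2 * (landauUpper * (1 + lam * ν + (lam * ν) ^ 2 / 2) -
          t * (S + ν)) = (landauUpper * lam ^ 2 * ν + (landauUpper * lam - t)) ^ 2 +
          (2 * landauUpper * lam ^ 2 * (landauUpper - t * S) - (t - landauUpper * lam) ^ 2) := by
        ring
      have : 0 ≤ 2 * landauUpper * lam ^ 2 * (landauUpper * (1 + lam * ν + (lam * ν) ^ 2 / 2) -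
          t * (S + ν)) := by
        rw [e]
        have := sq_nonneg (landauUpper * lam ^ 2 * ν + (landauUpper * lam - t))
        linarith
      have := (mul_nonneg_iff_of_pos_left ha).1 this
      linarith
  have hE := Real.quadratic_le_exp_of_nonneg (mul_nonneg hlam0.le hν.le)
  have hc0 : 0 < landauUpper := by norm_num [landauUpper]
  have hfin : t * (S + ν) ≤ landauUpper * Real.exp (lam * ν) :=
    hquad.trans (mul_le_mul_of_nonneg_left hE hc0.le)
  -- multiply through by `Γ(ν + 2)`
  refine le_of_mul_le_mul_left ?_ hG
  calc Real.Gamma (ν + 2) * (t * ((t ^ 3 / 2) ^ ν * besselSeries ν z))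
      = (t ^ 3 / 2) ^ ν * t * (Real.Gamma (ν + 2) * besselSeries ν z) := by ring
    _ ≤ (t ^ 3 / 2) ^ ν * t * (S + ν) := mul_le_mul_of_nonneg_left hGS (by positivity)
    _ = (t ^ 3 / 2) ^ ν * (t * (S + ν)) := by ring
    _ ≤ (t ^ 3 / 2) ^ ν * (landauUpper * Real.exp (lam * ν)) :=
        mul_le_mul_of_nonneg_left hfin hp.le
    _ = landauUpper * ((t ^ 3 / 2) ^ ν * Real.exp (lam * ν)) := by ring
    _ ≤ landauUpper * Real.Gamma (ν + 2) := mul_le_mul_of_nonneg_left hexp hc0.le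
    _ = Real.Gamma (ν + 2) * landauUpper := by ring

/-! ### The bound on Landau's constant -/

/-- The constant `1.0312` is just above `2 / (π L²)`: an amplitude bound `A J_ν² ≤ 2/π` suffices
as soon as `A ≥ 1.0312 x^{2/3}`. -/
lemma two_div_pi_le : 2 / Real.pi ≤ 1.0312 * landauUpper ^ 2 := by
  rw [div_le_iff₀ Real.pi_pos, landauUpper]
  have := Real.pi_gt_d6
  norm_num at this ⊢
  linarith

lemma abs_mul_besselJ_le_of_sub_sq_ge {ν t : ℝ} (hν : 0 < ν) (ht : 0 < t)
    (h : 1.0312 ^ 2 * t ^ 4 ≤ t ^ 6 - ν ^ 2) : |t * besselJ ν (t ^ 3)| ≤ landauUpper := by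
  have ht4 : 0 < t ^ 4 := by positivity
  have hlt : ν < t ^ 3 := by
    refine lt_of_pow_lt_pow_left₀ 2 (by positivity) ?_
    rw [← pow_mul]
    norm_num at h ⊢
    linarith
  have hS := sqrt_mul_besselJ_sq_le hν hlt
  have hs : 1.0312 * t ^ 2 ≤ √((t ^ 3) ^ 2 - ν ^ 2) := by
    refine Real.le_sqrt_of_sq_le ?_
    calc (1.0312 * t ^ 2) ^ 2 = 1.0312 ^ 2 * t ^ 4 := by ring
      _ ≤ t ^ 6 - ν ^ 2 := h
      _ = _ := by ring
  have h1 := mul_le_mul_of_nonneg_right hs (sq_nonneg (besselJ ν (t ^ 3)))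
  have h2 := two_div_pi_le
  refine abs_le_of_sq_le_sq ?_ (by norm_num [landauUpper])
  rw [mul_pow]
  linarith

lemma abs_mul_besselJ_le_of_le_half {ν t : ℝ} (hν : 0 < ν) (hν' : ν ≤ 1 / 2)
    (ht : 1.0312 ≤ t) : |t * besselJ ν (t ^ 3)| ≤ landauUpper := by
  have ht0 : 0 < t := by linarith
  have hS := mul_besselJ_sq_le hν hν' (x := t ^ 3) (by positivity)
  have h1 := mul_le_mul_of_nonneg_right ht (sq_nonneg (t * besselJ ν (t ^ 3)))
  have e : t * (t * besselJ ν (t ^ 3)) ^ 2 = t ^ 3 * besselJ ν (t ^ 3) ^ 2 := by ring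
  have h2 := two_div_pi_le
  refine abs_le_of_sq_le_sq ?_ (by norm_num [landauUpper])
  linarith

/-- If `x^{1/3} J_ν(x)` increases up to `b`, and the amplitude bound is good enough beyond `b`, then
the amplitude bound at `b` also covers all smaller arguments. -/
lemma abs_rpow_mul_besselJ_le_of_threshold {ν b : ℝ} (hν : 0 < ν) (hb : 0 < b)
    (hmono : ∀ y ∈ Ioc 0 b, 0 < besselJ ν y ∧ 0 ≤ besselEuler ν y + besselJ ν y / 3)
    (hlarge : ∀ t : ℝ, 0 < t → b ^ 2 ≤ t ^ 6 → 1.0312 ^ 2 * t ^ 4 ≤ t ^ 6 - ν ^ 2) {x : ℝ}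
    (hx : 0 < x) : |x ^ (1 / 3 : ℝ) * besselJ ν x| ≤ landauUpper := by
  have hbig : ∀ y, b ≤ y → |y ^ (1 / 3 : ℝ) * besselJ ν y| ≤ landauUpper := by
    intro y hy
    have hy0 : 0 < y := hb.trans_le hy
    have e : (y ^ (1 / 3 : ℝ)) ^ 3 = y := by
      rw [← Real.rpow_natCast, ← Real.rpow_mul hy0.le]; norm_num
    have ht : 0 < y ^ (1 / 3 : ℝ) := Real.rpow_pos_of_pos hy0 _
    have := abs_mul_besselJ_le_of_sub_sq_ge hν ht (hlarge _ ht (by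
      rw [show (y ^ (1 / 3 : ℝ)) ^ 6 = ((y ^ (1 / 3 : ℝ)) ^ 3) ^ 2 by ring, e]
      exact pow_le_pow_left₀ hb.le hy 2))
    rwa [e] at this
  rcases le_total b x with h | h
  · exact hbig x h
  have hm : MonotoneOn (fun y : ℝ => y ^ (1 / 3 : ℝ) * besselJ ν y) (Ioc 0 b) := by
    have hd : ∀ y, 0 < y → HasDerivAt (fun y : ℝ => y ^ (1 / 3 : ℝ) * besselJ ν y)
        (y ^ (1 / 3 : ℝ) / y * (besselEuler ν y + besselJ ν y / 3)) y := fun y hy => by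
      refine ((Real.hasDerivAt_rpow_const (p := 1 / 3) (Or.inl hy.ne')).mul
        (hasDerivAt_besselJ_euler hν.le hy)).congr_deriv ?_
      rw [Real.rpow_sub_one hy.ne']
      field_simp
      ring
    refine monotoneOn_of_deriv_nonneg (convex_Ioc 0 b)
      (fun y hy => (hd y hy.1).continuousAt.continuousWithinAt)
      (fun y hy => (hd y (interior_subset hy).1).differentiableAt.differentiableWithinAt)
      fun y hy => ?_
    have hy' := interior_subset hy
    rw [(hd y hy'.1).deriv]
    exact mul_nonneg (div_nonneg (Real.rpow_nonneg hy'.1.le _) hy'.1.le) (hmono y hy').2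
  have h1 : x ^ (1 / 3 : ℝ) * besselJ ν x ≤ b ^ (1 / 3 : ℝ) * besselJ ν b :=
    hm ⟨hx, h⟩ ⟨hb, le_rfl⟩ h
  rw [abs_of_nonneg (mul_nonneg (Real.rpow_nonneg hx.le _) (hmono x ⟨hx, h⟩).1.le)]
  exact h1.trans ((le_abs_self _).trans (hbig b le_rfl))

/-- A convenient form of the threshold condition `x² - ν² ≥ κ x^{4/3}`. -/
lemma sub_sq_ge_of_threshold {ν e t : ℝ} (he : 0 < e)
    (h : 1.0312 ^ 6 * (ν ^ 2 + e) ^ 2 ≤ e ^ 3) (ht : ν ^ 2 + e ≤ t ^ 6) :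
    1.0312 ^ 2 * t ^ 4 ≤ t ^ 6 - ν ^ 2 := by
  obtain ⟨D, hD⟩ : ∃ D, t ^ 6 = ν ^ 2 + e + D := ⟨t ^ 6 - (ν ^ 2 + e), by ring⟩
  have hD0 : 0 ≤ D := by linarith
  set X := ν ^ 2 + e with hX
  have hXe : e ≤ X := by rw [hX]; linarith [sq_nonneg ν]
  have hX0 : 0 < X := he.trans_le hXe
  have h1 : 1.0312 ^ 6 * X ≤ e ^ 2 := by
    have : 1.0312 ^ 6 * X * e ≤ e ^ 2 * e := by
      calc 1.0312 ^ 6 * X * e ≤ 1.0312 ^ 6 * X * X := mul_le_mul_of_nonneg_left hXe (by positivity)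
        _ = 1.0312 ^ 6 * X ^ 2 := by ring
        _ ≤ e ^ 3 := h
        _ = _ := by ring
    exact le_of_mul_le_mul_right this he
  have h2 : (1.0312 : ℝ) ^ 6 ≤ e := by
    have : (1.0312 : ℝ) ^ 6 * e ≤ e * e := by
      calc (1.0312 : ℝ) ^ 6 * e ≤ 1.0312 ^ 6 * X := mul_le_mul_of_nonneg_left hXe (by positivity)
        _ ≤ e ^ 2 := h1
        _ = _ := by ring
    exact le_of_mul_le_mul_right this he
  have h3 : (1.0312 ^ 2 * t ^ 4) ^ 3 ≤ (t ^ 6 - ν ^ 2) ^ 3 := by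
    have e1 : t ^ 6 - ν ^ 2 = e + D := by rw [hD, hX]; ring
    have e2 : (1.0312 ^ 2 * t ^ 4) ^ 3 = 1.0312 ^ 6 * (X + D) ^ 2 := by rw [← hD]; ring
    rw [e1, e2]
    have h4 := mul_le_mul_of_nonneg_right h1 hD0
    have h5 := mul_le_mul_of_nonneg_right h2 (sq_nonneg D)
    have h6 := pow_nonneg hD0 3
    have h7 := mul_nonneg (sq_nonneg e) hD0
    have h8 := mul_nonneg he.le (sq_nonneg D)
    nlinarith
  exact (Odd.strictMono_pow (n := 3) (by decide)).le_iff_le.1 h3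

lemma abs_rpow_mul_besselJ_le_of_le_half {ν x : ℝ} (hν : 0 < ν) (hν' : ν ≤ 1 / 2) (hx : 0 < x) :
    |x ^ (1 / 3 : ℝ) * besselJ ν x| ≤ landauUpper := by
  have e : (x ^ (1 / 3 : ℝ)) ^ 3 = x := by
    rw [← Real.rpow_natCast, ← Real.rpow_mul hx.le]; norm_num
  have ht : 0 < x ^ (1 / 3 : ℝ) := Real.rpow_pos_of_pos hx _
  rcases le_total (x ^ (1 / 3 : ℝ)) 1.0312 with h | h
  · have := abs_mul_besselJ_le_of_le hν ht h
    rwa [e] at this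
  · have := abs_mul_besselJ_le_of_le_half hν hν' h
    rwa [e] at this

/-- Intermediate orders, with threshold `b² = ν² + 2.55 ν + 0.36`. -/
lemma abs_rpow_mul_besselJ_le_of_le_eight {ν x : ℝ} (hν : 1 / 2 ≤ ν) (hν' : ν ≤ 8) (hx : 0 < x) :
    |x ^ (1 / 3 : ℝ) * besselJ ν x| ≤ landauUpper := by
  have hν0 : 0 < ν := by linarith
  have hX : 0 < ν ^ 2 + (2.55 * ν + 0.36) := by positivity
  have hb2 : √(ν ^ 2 + (2.55 * ν + 0.36)) ^ 2 = ν ^ 2 + (2.55 * ν + 0.36) := Real.sq_sqrt hX.le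
  refine abs_rpow_mul_besselJ_le_of_threshold hν0 (Real.sqrt_pos.2 hX) (fun y hy => ?_)
    (fun t _ h => sub_sq_ge_of_threshold (e := 2.55 * ν + 0.36) (by positivity) ?_ (by rwa [hb2] at h))
    hx
  · have hy2 : y ^ 2 ≤ ν ^ 2 + (2.55 * ν + 0.36) := by
      rw [← hb2]; exact pow_le_pow_left₀ hy.1.le hy.2 2
    refine besselJ_pos_and_increasing hν0.le hy.1 ?_ (by nlinarith)
    have := mul_le_mul_of_nonneg_right hy2 (show 0 ≤ ν + 2 by linarith)
    nlinarith [sq_nonneg (ν - 0.25)]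
  · have h1 : 0 ≤ (ν - 1 / 2) * (8 - ν) := mul_nonneg (by linarith) (by linarith)
    nlinarith [mul_nonneg h1 hν0.le, mul_nonneg h1 (sq_nonneg ν), sq_nonneg ν]

/-- Large orders: with `m = ν^{1/3}`, the Riccati comparison starts at `a² = ν² - (0.63 m²)²` and
reaches the threshold `b² = ν² + κ (m⁴ + 0.85 m²)`. -/
lemma abs_rpow_mul_besselJ_le_of_eight_le {ν x : ℝ} (hν : 8 ≤ ν) (hx : 0 < x) :
    |x ^ (1 / 3 : ℝ) * besselJ ν x| ≤ landauUpper := by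
  obtain ⟨m, hm0, hm⟩ : ∃ m : ℝ, 0 < m ∧ ν = m ^ 3 :=
    ⟨ν ^ (1 / 3 : ℝ), Real.rpow_pos_of_pos (by linarith) _, by
      rw [← Real.rpow_natCast, ← Real.rpow_mul (by linarith)]; norm_num⟩
  have hm2 : 2 ≤ m := by
    refine le_of_pow_le_pow_left₀ (n := 3) (by norm_num) hm0.le ?_
    rw [← hm]; linarith
  have hν0 : 0 < ν := by linarith
  obtain ⟨w, hw⟩ : ∃ w, w = m ^ 2 := ⟨_, rfl⟩
  have hw4 : 4 ≤ w := by rw [hw]; nlinarith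
  have hw0 : 0 < w := by linarith
  have hνw : ν ^ 2 = w ^ 3 := by rw [hm, hw]; ring
  have hA : 0 < w ^ 3 - 0.3969 * w ^ 2 := by
    have : w ^ 3 - 0.3969 * w ^ 2 = w ^ 2 * (w - 0.3969) := by ring
    rw [this]
    exact mul_pos (by positivity) (by linarith)
  have ha2 : √(w ^ 3 - 0.3969 * w ^ 2) ^ 2 = w ^ 3 - 0.3969 * w ^ 2 := Real.sq_sqrt hA.le
  set a := √(w ^ 3 - 0.3969 * w ^ 2) with ha
  have ha0 : 0 < a := Real.sqrt_pos.2 hA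
  set ε := 1.0312 ^ 2 * (w ^ 2 + 0.85 * w) with hε
  have hε0 : 0 < ε := by positivity
  have hB : 0 < ν ^ 2 + ε := by positivity
  have hb2 : √(ν ^ 2 + ε) ^ 2 = ν ^ 2 + ε := Real.sq_sqrt hB.le
  set b := √(ν ^ 2 + ε) with hb
  have hb0 : 0 < b := Real.sqrt_pos.2 hB
  have hend : (b ^ 2 - a ^ 2) ^ 2 ≤ 4 * (0.63 * w) * b ^ 2 := by
    rw [ha2, hb2, hνw, hε]
    have h1 : 0 ≤ (w - 4) * w ^ 3 := mul_nonneg (by linarith) (by positivity)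
    nlinarith [mul_nonneg h1 hw0.le, sq_nonneg w, pow_pos hw0 3]
  refine abs_rpow_mul_besselJ_le_of_threshold hν0 hb0 (fun y hy => ?_)
    (fun t _ h => sub_sq_ge_of_threshold hε0 ?_ (by rwa [hb2] at h)) hx
  · rcases le_total y a with h | h
    · have h1 : y ^ 2 ≤ ν * (ν + 1) := by
        have := pow_le_pow_left₀ hy.1.le h 2
        rw [ha2, ← hνw] at this
        nlinarith [sq_nonneg w]
      have h2 := besselJ_pos_of_sq_le hν0 hy.1 h1
      have h3 := besselEuler_pos_of_sq_le hν0 hy.1 h1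
      exact ⟨h2, by linarith⟩
    · have h4 := besselJ_pos_of_riccati (α := 0.63 * w) (b := b) hν0 ha0 (by linarith)
        (by rw [ha2, hνw]; ring) (fun s hs => by
          have hs1 : a ^ 2 ≤ s ^ 2 := pow_le_pow_left₀ ha0.le hs.1 2
          have hs2 : s ^ 2 ≤ b ^ 2 := pow_le_pow_left₀ (ha0.le.trans hs.1) hs.2 2
          -- `(Y - A)² / Y` increases in `Y ≥ A`
          have h5 : (s ^ 2 - a ^ 2) ^ 2 * b ^ 2 ≤ (b ^ 2 - a ^ 2) ^ 2 * s ^ 2 := by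
            have e : (b ^ 2 - a ^ 2) ^ 2 * s ^ 2 - (s ^ 2 - a ^ 2) ^ 2 * b ^ 2 =
                (b ^ 2 - s ^ 2) * (s ^ 2 * b ^ 2 - a ^ 2 * a ^ 2) := by ring
            have h6 : a ^ 2 * a ^ 2 ≤ s ^ 2 * b ^ 2 :=
              mul_le_mul hs1 (hs1.trans hs2) (sq_nonneg a) (sq_nonneg s)
            have := mul_nonneg (sub_nonneg.2 hs2) (sub_nonneg.2 h6)
            linarith
          have h7 := mul_le_mul_of_nonneg_right hend (sq_nonneg s)
          refine le_of_mul_le_mul_right (h5.trans (h7.trans_eq ?_)) (by positivity : 0 < b ^ 2)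
          ring) y ⟨h, hy.2⟩
      exact ⟨h4.1, by linarith [h4.1, h4.2]⟩
  · rw [hνw, hε, mul_pow, ← pow_mul]
    refine mul_le_mul_of_nonneg_left ?_ (by positivity)
    have hu : 0 ≤ w - 4 := by linarith
    obtain ⟨v, rfl⟩ : ∃ v, w = 4 + v := ⟨w - 4, by ring⟩
    have hv : 0 ≤ v := by linarith
    have e : ((4 + v) ^ 2 + 0.85 * (4 + v)) ^ 3 -
        ((4 + v) ^ 3 + 1.0312 ^ 2 * ((4 + v) ^ 2 + 0.85 * (4 + v))) ^ 2 ≥ 0 := by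
      ring_nf
      positivity
    linarith

theorem abs_rpow_mul_besselJ_le_landauUpper {ν x : ℝ} (hν : 0 < ν) (hx : 0 < x) :
    |x ^ (1 / 3 : ℝ) * besselJ ν x| ≤ landauUpper := by
  rcases le_total ν (1 / 2) with h | h
  · exact abs_rpow_mul_besselJ_le_of_le_half hν h hx
  rcases le_total ν 8 with h' | h'
  · exact abs_rpow_mul_besselJ_le_of_le_eight h h' hx
  · exact abs_rpow_mul_besselJ_le_of_eight_le h' hx

lemma bddAbove_landauSet : BddAbove landauSet :=
  ⟨landauUpper, by
    rintro y ⟨ν, r, hν, hr, rfl⟩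
    exact abs_rpow_mul_besselJ_le_landauUpper hν hr⟩

lemma landauSet_nonempty : landauSet.Nonempty := ⟨_, 1, 1, one_pos, one_pos, rfl⟩

lemma isLUB_landauL : IsLUB landauSet landauL := isLUB_csSup landauSet_nonempty bddAbove_landauSet

lemma landauL_le_landauUpper : landauL ≤ landauUpper :=
  csSup_le landauSet_nonempty (by
    rintro y ⟨ν, r, hν, hr, rfl⟩
    exact abs_rpow_mul_besselJ_le_landauUpper hν hr)

/-- The supremum over `ν > 0` also bounds the case `ν = 0`, by continuity in the order. -/
lemma abs_rpow_mul_besselJ_le_landauL {ν x : ℝ} (hν : 0 ≤ ν) (hx : 0 < x) :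
    |x ^ (1 / 3 : ℝ) * besselJ ν x| ≤ landauL := by
  have hpos : ∀ μ : ℝ, 0 < μ → |x ^ (1 / 3 : ℝ) * besselJ μ x| ≤ landauL := fun μ hμ =>
    isLUB_landauL.1 ⟨μ, x, hμ, hx, rfl⟩
  rcases hν.eq_or_lt with rfl | h
  · refine le_of_tendsto ((tendsto_besselJ_zero hx).const_mul (x ^ (1 / 3 : ℝ))).abs ?_
    filter_upwards [self_mem_nhdsWithin] with μ hμ
    exact hpos μ hμ
  · exact hpos ν h

/-- The lower bound comes from `x^{1/3} J_0(x)` at `x^{1/3} = 0.922`. -/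
lemma le_landauL : 0.785746 ≤ landauL := by
  have h := abs_rpow_mul_besselJ_le_landauL (ν := 0) le_rfl (x := 0.922 ^ 3) (by positivity)
  have e : ((0.922 : ℝ) ^ 3) ^ (1 / 3 : ℝ) = 0.922 := by
    rw [← Real.rpow_natCast, ← Real.rpow_mul (by norm_num)]; norm_num
  rw [e, besselJ_eq, Real.rpow_zero, one_mul] at h
  obtain ⟨hanti, hlim⟩ := besselSeries_alternating (ν := 0) le_rfl
    (z := ((0.922 : ℝ) ^ 3) ^ 2 / 4) (by positivity) (by norm_num)
  have h2 := hanti.alternating_series_le_tendsto hlim 3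
  have hG : ∀ i : ℕ, Real.Gamma (0 + i + 1) = (i.factorial : ℝ) := fun i => by
    rw [zero_add, Real.Gamma_nat_eq_factorial]
  simp only [hG, Finset.sum_range_succ, Finset.sum_range_zero, Nat.factorial] at h2
  have h3 : (0.8522194 : ℝ) ≤ besselSeries 0 (((0.922 : ℝ) ^ 3) ^ 2 / 4) :=
    le_trans (by norm_num) h2
  refine le_trans ?_ ((le_abs_self _).trans h)
  refine le_trans ?_ (mul_le_mul_of_nonneg_left h3 (by norm_num))
  norm_num

/-! ### The norm bound -/

lemma landauL_pos : 0 < landauL := lt_of_lt_of_le (by norm_num) le_landauL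

/-- The constant `2^ν Γ(ν+1)`, for which `J_ν(r) ∼ r^ν / (2^ν Γ(ν+1))` as `r → 0`. -/
noncomputable def besselScale (ν : ℝ) : ℝ := 2 ^ ν * Real.Gamma (ν + 1)

lemma besselScale_pos {ν : ℝ} (hν : 0 ≤ ν) : 0 < besselScale ν :=
  mul_pos (Real.rpow_pos_of_pos two_pos ν) (Real.Gamma_pos_of_pos (by linarith))

/-- The common factor of the bounds for all exponents; `s` stands for `d / q`, and is `0` for
`q = ∞`. -/
noncomputable def boundFactor (d : ℕ) (s : ℝ) (k : ℕ) : ℝ :=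
  (besselScale ((d : ℝ) / 2 - 1 + k))⁻¹ *
    (landauL * besselScale ((d : ℝ) / 2 - 1 + k)) ^ ((k + s) / ((d : ℝ) / 2 + k - 2 / 3))

lemma boundFactor_eq {d : ℕ} (hd : 2 ≤ d) (s : ℝ) (k : ℕ) :
    boundFactor d s k = landauL ^ (((k : ℝ) + s) / ((d : ℝ) / 2 + k - 2 / 3))
    * (2 : ℝ) ^ ((((d : ℝ) / 2 + k - 1) * (-(d : ℝ) / 2 + 2 / 3 + s))
        / ((d : ℝ) / 2 + k - 2 / 3))
    * Real.Gamma ((d : ℝ) / 2 + k) ^ ((-(d : ℝ) / 2 + 2 / 3 + s) / ((d : ℝ) / 2 + k - 2 / 3)) := by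
  have hd' : (2 : ℝ) ≤ d := by exact_mod_cast hd
  have hk : (0 : ℝ) ≤ k := k.cast_nonneg
  have hν : (0 : ℝ) ≤ (d : ℝ) / 2 - 1 + k := by linarith
  have hA := besselScale_pos hν
  have hN : (d : ℝ) / 2 + k - 2 / 3 ≠ 0 := by linarith
  have e : (-(d : ℝ) / 2 + 2 / 3 + s) / ((d : ℝ) / 2 + k - 2 / 3)
      = (k + s) / ((d : ℝ) / 2 + k - 2 / 3) - 1 := by
    rw [eq_sub_iff_add_eq, div_add_one hN]; ring_nf
  have hsc : besselScale ((d : ℝ) / 2 - 1 + k)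
      = 2 ^ ((d : ℝ) / 2 + k - 1) * Real.Gamma ((d : ℝ) / 2 + k) := by
    rw [besselScale]; congr 2 <;> ring_nf
  rw [boundFactor, Real.mul_rpow landauL_pos.le hA.le, mul_div_assoc _ _ ((d : ℝ) / 2 + k - 2 / 3),
    Real.rpow_mul two_pos.le, mul_assoc (landauL ^ _),
    ← Real.mul_rpow (by positivity) (Real.Gamma_pos_of_pos (by linarith)).le, ← hsc, e,
    Real.rpow_sub_one hA.ne']
  ring

lemma boundFactor_pos {d : ℕ} (hd : 2 ≤ d) (s : ℝ) (k : ℕ) : 0 < boundFactor d s k := by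
  have hd' : (2 : ℝ) ≤ d := by exact_mod_cast hd
  have hν : (0 : ℝ) ≤ (d : ℝ) / 2 - 1 + k := by linarith [(k.cast_nonneg : (0 : ℝ) ≤ k)]
  have := besselScale_pos hν
  have := landauL_pos
  unfold boundFactor
  positivity

lemma besselBoundTop_eq {d : ℕ} (hd : 2 ≤ d) (k : ℕ) :
    besselBoundTop d k = boundFactor d 0 k := by
  rw [boundFactor_eq hd, besselBoundTop]; simp

lemma besselBoundReal_eq {d : ℕ} (hd : 2 ≤ d) (p : ℝ) (k : ℕ) :
    besselBoundReal d p k = boundFactor d (d / p) k *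
      (1 / ((k : ℝ) * p + d) + 1 / (p * ((d : ℝ) / 2 - 2 / 3) - d)) ^ (1 / p) := by
  rw [boundFactor_eq hd, besselBoundReal]

lemma abs_radial_le_near {d : ℕ} (hd : 2 ≤ d) (k : ℕ) {r : ℝ} (hr : 0 < r) :
    |r ^ (-(d : ℝ) / 2 + 1) * besselJ ((d : ℝ) / 2 - 1 + k) r|
      ≤ (besselScale ((d : ℝ) / 2 - 1 + k))⁻¹ * r ^ (k : ℝ) := by
  have hd' : (2 : ℝ) ≤ d := by exact_mod_cast hd
  have hν : (0 : ℝ) ≤ (d : ℝ) / 2 - 1 + k := by linarith [(k.cast_nonneg : (0 : ℝ) ≤ k)]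
  rw [abs_mul, abs_of_pos (Real.rpow_pos_of_pos hr _)]
  refine (mul_le_mul_of_nonneg_left (abs_besselJ_le hν hr) (by positivity)).trans_eq ?_
  have e : r ^ (k : ℝ) = r ^ (-(d : ℝ) / 2 + 1) * r ^ ((d : ℝ) / 2 - 1 + k) := by
    rw [← Real.rpow_add hr]; ring_nf
  rw [e, Real.div_rpow hr.le two_pos.le, besselScale, mul_inv]
  ring

lemma abs_radial_le_far {d : ℕ} (hd : 2 ≤ d) (k : ℕ) {r : ℝ} (hr : 0 < r) :
    |r ^ (-(d : ℝ) / 2 + 1) * besselJ ((d : ℝ) / 2 - 1 + k) r|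
      ≤ landauL * r ^ (-((d : ℝ) / 2 - 2 / 3)) := by
  have hd' : (2 : ℝ) ≤ d := by exact_mod_cast hd
  have hν : (0 : ℝ) ≤ (d : ℝ) / 2 - 1 + k := by linarith [(k.cast_nonneg : (0 : ℝ) ≤ k)]
  have e : r ^ (-(d : ℝ) / 2 + 1) = r ^ (-((d : ℝ) / 2 - 2 / 3)) * r ^ (1 / 3 : ℝ) := by
    rw [← Real.rpow_add hr]; ring_nf
  rw [e, mul_assoc, abs_mul, abs_of_pos (Real.rpow_pos_of_pos hr _), mul_comm landauL]
  exact mul_le_mul_of_nonneg_left (abs_rpow_mul_besselJ_le_landauL hν hr) (by positivity)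

/-- The radius at which the bounds near the origin and at infinity agree. -/
noncomputable def crossRadius (d k : ℕ) : ℝ :=
  (landauL * besselScale ((d : ℝ) / 2 - 1 + k)) ^ (1 / ((d : ℝ) / 2 + k - 2 / 3))

/-- Positivity, the value of the first bound (times `R^s`) at the crossing radius `R`, and the
agreement of the two bounds there. -/
lemma crossRadius_spec {d : ℕ} (hd : 2 ≤ d) (k : ℕ) :
    0 < crossRadius d k ∧
    (∀ s : ℝ, (besselScale ((d : ℝ) / 2 - 1 + k))⁻¹ * crossRadius d k ^ ((k : ℝ) + s)
      = boundFactor d s k) ∧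
    landauL * crossRadius d k ^ (-((d : ℝ) / 2 - 2 / 3))
      = (besselScale ((d : ℝ) / 2 - 1 + k))⁻¹ * crossRadius d k ^ (k : ℝ) := by
  have hd' : (2 : ℝ) ≤ d := by exact_mod_cast hd
  have hk : (0 : ℝ) ≤ k := k.cast_nonneg
  have hν : (0 : ℝ) ≤ (d : ℝ) / 2 - 1 + k := by linarith
  have hA := besselScale_pos hν
  have hL := landauL_pos
  have hN : (d : ℝ) / 2 + k - 2 / 3 ≠ 0 := by linarith
  have hR : 0 < crossRadius d k := by unfold crossRadius; positivity
  refine ⟨hR, fun s => ?_, ?_⟩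
  · rw [boundFactor, crossRadius, ← Real.rpow_mul (by positivity)]
    congr 2; ring
  · have h : crossRadius d k ^ ((d : ℝ) / 2 + k - 2 / 3)
        = landauL * besselScale ((d : ℝ) / 2 - 1 + k) := by
      rw [crossRadius, ← Real.rpow_mul (by positivity), one_div_mul_cancel hN, Real.rpow_one]
    have e : crossRadius d k ^ (k : ℝ) = crossRadius d k ^ ((d : ℝ) / 2 + k - 2 / 3)
        * crossRadius d k ^ (-((d : ℝ) / 2 - 2 / 3)) := by
      rw [← Real.rpow_add hR]; ring_nf
    rw [e, h, mul_comm landauL (besselScale _), mul_assoc, inv_mul_cancel_left₀ hA.ne']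

/-- The minimum of the two bounds is largest at the radius where they agree. -/
lemma besselNorm_top_le {d : ℕ} (hd : 2 ≤ d) (k : ℕ) :
    besselNorm d ∞ k ≤ ENNReal.ofReal (besselBound d ∞ k) := by
  have hd' : (2 : ℝ) ≤ d := by exact_mod_cast hd
  have hν : (0 : ℝ) ≤ (d : ℝ) / 2 - 1 + k := by linarith [(k.cast_nonneg : (0 : ℝ) ≤ k)]
  have hA := besselScale_pos hν
  obtain ⟨hR, h1, h2⟩ := crossRadius_spec hd k
  have h0 := h1 0
  rw [add_zero] at h0
  rw [besselNorm, if_pos rfl, besselBound, if_pos rfl, besselBoundTop_eq hd]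
  refine iSup₂_le fun r hr => ENNReal.ofReal_le_ofReal ?_
  have hr : 0 < r := hr
  rcases le_total r (crossRadius d k) with h | h
  · refine (abs_radial_le_near hd k hr).trans ?_
    rw [← h0]
    exact mul_le_mul_of_nonneg_left (Real.rpow_le_rpow hr.le h k.cast_nonneg) (by positivity)
  · refine (abs_radial_le_far hd k hr).trans ?_
    rw [← h0, ← h2]
    exact mul_le_mul_of_nonneg_left
      (Real.rpow_le_rpow_of_nonpos hR h (by linarith)) landauL_pos.le

lemma lintegral_Ioc_rpow {R a : ℝ} (hR : 0 < R) (ha : -1 < a) :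
    ∫⁻ r in Ioc 0 R, ENNReal.ofReal (r ^ a) = ENNReal.ofReal (R ^ (a + 1) / (a + 1)) := by
  have hi := (intervalIntegrable_iff_integrableOn_Ioc_of_le hR.le).1
    (intervalIntegral.intervalIntegrable_rpow' (a := 0) (b := R) ha)
  rw [← ofReal_integral_eq_lintegral_ofReal hi, ← intervalIntegral.integral_of_le hR.le,
    integral_rpow (Or.inl ha), Real.zero_rpow (by linarith), sub_zero]
  filter_upwards [ae_restrict_mem measurableSet_Ioc] with r hr
  exact Real.rpow_nonneg hr.1.le _

lemma lintegral_Ioi_rpow {R a : ℝ} (hR : 0 < R) (ha : a < -1) :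
    ∫⁻ r in Ioi R, ENNReal.ofReal (r ^ a) = ENNReal.ofReal (R ^ (a + 1) / -(a + 1)) := by
  rw [← ofReal_integral_eq_lintegral_ofReal (integrableOn_Ioi_rpow_of_lt ha hR),
    integral_Ioi_rpow_of_lt ha hR, neg_div, div_neg]
  filter_upwards [ae_restrict_mem measurableSet_Ioi] with r hr
  exact Real.rpow_nonneg (hR.trans hr).le _

/-- Splitting the integral at the radius `R` where the two bounds agree. -/
lemma besselNorm_real_le {d : ℕ} (hd : 2 ≤ d) {q : ℝ≥0∞} (hq : q ≠ ∞) (hp : 0 < q.toReal)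
    (hpd : (d : ℝ) < q.toReal * ((d : ℝ) / 2 - 2 / 3)) (k : ℕ) :
    besselNorm d q k ≤ ENNReal.ofReal (besselBound d q k) := by
  rw [besselNorm, if_neg hq, besselBound, if_neg hq, besselBoundReal_eq hd]
  set p := q.toReal
  set β := (d : ℝ) / 2 - 2 / 3 with hβ
  set A := besselScale ((d : ℝ) / 2 - 1 + k) with hAdef
  set R := crossRadius d k with hRdef
  have hd' : (2 : ℝ) ≤ d := by exact_mod_cast hd
  have hk : (0 : ℝ) ≤ k := k.cast_nonneg
  have hν : (0 : ℝ) ≤ (d : ℝ) / 2 - 1 + k := by linarith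
  have hA : 0 < A := besselScale_pos hν
  have hL := landauL_pos
  obtain ⟨hR, h1, h2⟩ := crossRadius_spec hd k
  rw [← hAdef, ← hRdef] at h1 h2
  rw [← hRdef] at hR
  rw [← hβ] at h2
  have hkp : 0 < (k : ℝ) * p + d := by positivity
  have hbp : 0 < p * β - d := by linarith
  have hB := boundFactor_pos hd (d / p) k
  have hBp : boundFactor d (d / p) k ^ p = (A⁻¹) ^ p * R ^ ((k : ℝ) * p + d) := by
    rw [← h1, Real.mul_rpow (by positivity) (by positivity), ← Real.rpow_mul hR.le]
    congr 2; field_simp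
  have near : ∫⁻ r in Ioc 0 R, ENNReal.ofReal
      (|r ^ (-(d : ℝ) / 2 + 1) * besselJ ((d : ℝ) / 2 - 1 + k) r| ^ p * r ^ ((d : ℝ) - 1))
      ≤ ENNReal.ofReal (boundFactor d (d / p) k ^ p * (1 / ((k : ℝ) * p + d))) := by
    calc _ ≤ ∫⁻ r in Ioc 0 R, ENNReal.ofReal ((A⁻¹) ^ p) *
          ENNReal.ofReal (r ^ ((k : ℝ) * p + d - 1)) := by
          refine setLIntegral_mono' measurableSet_Ioc fun r hr => ?_
          rw [← ENNReal.ofReal_mul (by positivity)]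
          refine ENNReal.ofReal_le_ofReal ?_
          have hr0 : 0 < r := hr.1
          have e : (A⁻¹) ^ p * r ^ ((k : ℝ) * p + d - 1)
              = (A⁻¹ * r ^ (k : ℝ)) ^ p * r ^ ((d : ℝ) - 1) := by
            rw [Real.mul_rpow (by positivity) (by positivity), ← Real.rpow_mul hr0.le, mul_assoc,
              ← Real.rpow_add hr0, add_sub_assoc]
          rw [e]
          exact mul_le_mul_of_nonneg_right (Real.rpow_le_rpow (abs_nonneg _)
            (abs_radial_le_near hd k hr0) hp.le) (by positivity)
      _ = _ := by
          rw [lintegral_const_mul' _ _ ENNReal.ofReal_ne_top, lintegral_Ioc_rpow hR (by linarith),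
            ← ENNReal.ofReal_mul (by positivity), sub_add_cancel, hBp]
          ring_nf
  have far : ∫⁻ r in Ioi R, ENNReal.ofReal
      (|r ^ (-(d : ℝ) / 2 + 1) * besselJ ((d : ℝ) / 2 - 1 + k) r| ^ p * r ^ ((d : ℝ) - 1))
      ≤ ENNReal.ofReal (boundFactor d (d / p) k ^ p * (1 / (p * β - d))) := by
    have hc : boundFactor d (d / p) k ^ p = landauL ^ p * R ^ (-(p * β - d)) := by
      have e1 : R ^ ((k : ℝ) * p + d) = (R ^ (k : ℝ)) ^ p * R ^ (d : ℝ) := by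
        rw [← Real.rpow_mul hR.le, ← Real.rpow_add hR]
      rw [hBp, e1, ← mul_assoc, ← Real.mul_rpow (by positivity) (by positivity), ← h2,
        Real.mul_rpow hL.le (by positivity), ← Real.rpow_mul hR.le, mul_assoc, ← Real.rpow_add hR]
      ring_nf
    calc _ ≤ ∫⁻ r in Ioi R, ENNReal.ofReal (landauL ^ p) *
          ENNReal.ofReal (r ^ (-(p * β - d) - 1)) := by
          refine setLIntegral_mono' measurableSet_Ioi fun r hr => ?_
          rw [← ENNReal.ofReal_mul (by positivity)]
          refine ENNReal.ofReal_le_ofReal ?_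
          have hr0 : 0 < r := hR.trans hr
          have e : landauL ^ p * r ^ (-(p * β - d) - 1)
              = (landauL * r ^ (-β)) ^ p * r ^ ((d : ℝ) - 1) := by
            rw [Real.mul_rpow hL.le (by positivity), ← Real.rpow_mul hr0.le, mul_assoc,
              ← Real.rpow_add hr0]
            ring_nf
          rw [e]
          exact mul_le_mul_of_nonneg_right (Real.rpow_le_rpow (abs_nonneg _)
            (abs_radial_le_far hd k hr0) hp.le) (by positivity)
      _ = _ := by
          rw [lintegral_const_mul' _ _ ENNReal.ofReal_ne_top, lintegral_Ioi_rpow hR (by linarith),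
            ← ENNReal.ofReal_mul (by positivity), sub_add_cancel, hc, neg_neg]
          ring_nf
  have hs : 0 < 1 / ((k : ℝ) * p + d) + 1 / (p * β - d) := by positivity
  have total : ∫⁻ r in Ioi 0, ENNReal.ofReal
      (|r ^ (-(d : ℝ) / 2 + 1) * besselJ ((d : ℝ) / 2 - 1 + k) r| ^ p * r ^ ((d : ℝ) - 1))
      ≤ ENNReal.ofReal (boundFactor d (d / p) k ^ p *
        (1 / ((k : ℝ) * p + d) + 1 / (p * β - d))) := by
    rw [← Ioc_union_Ioi_eq_Ioi hR.le, mul_add, ENNReal.ofReal_add (by positivity) (by positivity)]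
    exact (lintegral_union_le _ _ _).trans (add_le_add near far)
  refine (ENNReal.rpow_le_rpow total (by positivity)).trans_eq ?_
  rw [ENNReal.ofReal_rpow_of_nonneg (by positivity) (by positivity),
    Real.mul_rpow (by positivity) hs.le, ← Real.rpow_mul hB.le, mul_one_div_cancel hp.ne',
    Real.rpow_one]

/-! ### Monotonicity of the bound -/

/-- Log-convexity of `Γ` at `ν + 1`, a convex combination of `1` and `ν + 2`. -/
lemma log_Gamma_add_one_le {ν : ℝ} (hν : 0 ≤ ν) :
    Real.log (Real.Gamma (ν + 1)) ≤ ν * Real.log (ν + 1) := by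
  have hν1 : 0 < ν + 1 := by linarith
  have h := Real.convexOn_log_Gamma.2 (mem_Ioi.2 (one_pos : (0 : ℝ) < 1))
    (mem_Ioi.2 (add_pos hν1 one_pos))
    (show 0 ≤ 1 / (ν + 1) by positivity) (show 0 ≤ ν / (ν + 1) by positivity)
    (by field_simp; ring)
  have e : 1 / (ν + 1) * 1 + ν / (ν + 1) * (ν + 1 + 1) = ν + 1 := by field_simp; ring
  simp only [smul_eq_mul, Function.comp_apply, e, Real.Gamma_one, Real.log_one, mul_zero, zero_add,
    Real.Gamma_add_one hν1.ne', Real.log_mul hν1.ne' (Real.Gamma_pos_of_pos hν1).ne'] at h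
  rw [div_mul_eq_mul_div, le_div_iff₀ hν1] at h
  nlinarith

/-- The logarithm of the crossing radius, as a function of the order, increases along unit
steps. -/
lemma log_cross_lt {ν : ℝ} (hν : 0 ≤ ν) :
    Real.log (landauL * besselScale ν) / (ν + 1 / 3)
      < Real.log (landauL * besselScale (ν + 1)) / (ν + 1 + 1 / 3) := by
  have hL := landauL_pos
  have hA := besselScale_pos hν
  have hν1 : 0 < ν + 1 := by linarith
  have hG := Real.Gamma_pos_of_pos hν1
  have hstep : besselScale (ν + 1) = besselScale ν * (2 * (ν + 1)) := by
    rw [besselScale, besselScale, Real.Gamma_add_one hν1.ne', Real.rpow_add_one two_ne_zero]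
    ring
  have hlog : Real.log (landauL * besselScale (ν + 1))
      = Real.log (landauL * besselScale ν) + Real.log (2 * (ν + 1)) := by
    rw [hstep, ← mul_assoc, Real.log_mul (by positivity) (by positivity)]
  have h1 : Real.log landauL < 0 := Real.log_neg hL
    (landauL_le_landauUpper.trans_lt (by norm_num [landauUpper]))
  have h2 : 0 < Real.log (2 * (ν + 1)) := Real.log_pos (by linarith)
  have h3 : Real.log (landauL * besselScale ν)
      ≤ Real.log landauL + ν * Real.log (2 * (ν + 1)) := by
    rw [Real.log_mul hL.ne' hA.ne', besselScale, Real.log_mul (by positivity) hG.ne',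
      Real.log_rpow two_pos, Real.log_mul two_ne_zero hν1.ne']
    linarith [log_Gamma_add_one_le hν]
  rw [hlog, div_lt_div_iff₀ (by positivity) (by positivity)]
  nlinarith

lemma log_boundFactor {d : ℕ} (hd : 2 ≤ d) (s : ℝ) (k : ℕ) :
    Real.log (boundFactor d s k) = Real.log landauL - ((d : ℝ) / 2 - 2 / 3 - s) *
      (Real.log (landauL * besselScale ((d : ℝ) / 2 - 1 + k)) / ((d : ℝ) / 2 - 1 + k + 1 / 3)) := by
  have hd' : (2 : ℝ) ≤ d := by exact_mod_cast hd
  have hν : (0 : ℝ) ≤ (d : ℝ) / 2 - 1 + k := by linarith [(k.cast_nonneg : (0 : ℝ) ≤ k)]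
  have hL := landauL_pos
  have hA := besselScale_pos hν
  have hN : (d : ℝ) / 2 - 1 + k + 1 / 3 ≠ 0 := by linarith
  have eN : (d : ℝ) / 2 + k - 2 / 3 = (d : ℝ) / 2 - 1 + k + 1 / 3 := by ring
  have e : (k + s) / ((d : ℝ) / 2 - 1 + k + 1 / 3)
      = 1 - ((d : ℝ) / 2 - 2 / 3 - s) / ((d : ℝ) / 2 - 1 + k + 1 / 3) := by
    rw [eq_sub_iff_add_eq, ← add_div, div_eq_one_iff_eq hN]; ring
  rw [boundFactor, Real.log_mul (by positivity) (by positivity), Real.log_inv,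
    Real.log_rpow (by positivity), eN, e, Real.log_mul hL.ne' hA.ne']
  ring

lemma boundFactor_succ_lt {d : ℕ} (hd : 2 ≤ d) {s : ℝ} (hs : s < (d : ℝ) / 2 - 2 / 3) (k : ℕ) :
    boundFactor d s (k + 1) < boundFactor d s k := by
  have hd' : (2 : ℝ) ≤ d := by exact_mod_cast hd
  have hν : (0 : ℝ) ≤ (d : ℝ) / 2 - 1 + k := by linarith [(k.cast_nonneg : (0 : ℝ) ≤ k)]
  rw [← Real.log_lt_log_iff (boundFactor_pos hd s _) (boundFactor_pos hd s _), log_boundFactor hd,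
    log_boundFactor hd, Nat.cast_succ, ← add_assoc]
  exact sub_lt_sub_left (mul_lt_mul_of_pos_left (log_cross_lt hν) (by linarith)) _

lemma strictAnti_besselBoundTop {d : ℕ} (hd : 2 ≤ d) : StrictAnti (besselBoundTop d) := by
  have hd' : (2 : ℝ) ≤ d := by exact_mod_cast hd
  refine strictAnti_nat_of_succ_lt fun k => ?_
  rw [besselBoundTop_eq hd, besselBoundTop_eq hd]
  exact boundFactor_succ_lt hd (by linarith) k

lemma strictAnti_besselBoundReal {d : ℕ} (hd : 2 ≤ d) {p : ℝ} (hp : 0 < p)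
    (hpd : (d : ℝ) < p * ((d : ℝ) / 2 - 2 / 3)) : StrictAnti (besselBoundReal d p) := by
  have hd' : (2 : ℝ) ≤ d := by exact_mod_cast hd
  refine strictAnti_nat_of_succ_lt fun k => ?_
  rw [besselBoundReal_eq hd, besselBoundReal_eq hd]
  have hb : 0 < p * ((d : ℝ) / 2 - 2 / 3) - d := by linarith
  refine mul_lt_mul' (boundFactor_succ_lt hd ?_ k).le ?_ (by positivity) (boundFactor_pos hd _ k)
  · rw [div_lt_iff₀ hp]; linarith
  · refine Real.rpow_lt_rpow (by positivity) (add_lt_add_left ?_ _) (by positivity)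
    rw [Nat.cast_succ]
    exact one_div_lt_one_div_of_lt (by positivity) (by nlinarith)

/-- The admissible finite exponents are those for which the bound at infinity is integrable. -/
lemma lt_toReal_mul_of_lt {d : ℕ} (hd : 2 ≤ d) {q : ℝ≥0∞} (hq' : q ≠ ∞)
    (hq : ENNReal.ofReal (2 * (d : ℝ) / ((d : ℝ) - 4 / 3)) < q) :
    0 < q.toReal ∧ (d : ℝ) < q.toReal * ((d : ℝ) / 2 - 2 / 3) := by
  have hd' : (2 : ℝ) ≤ d := by exact_mod_cast hd
  have h4 : 0 < (d : ℝ) - 4 / 3 := by linarith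
  have h : 2 * (d : ℝ) / ((d : ℝ) - 4 / 3) < q.toReal :=
    (ENNReal.ofReal_lt_iff_lt_toReal (by positivity) hq').1 hq
  refine ⟨lt_of_le_of_lt (by positivity) h, ?_⟩
  rw [div_lt_iff₀ h4] at h
  linarith

theorem theorem2 (d : ℕ) (hd : 2 ≤ d) (q : ℝ≥0∞)
    (hq : ENNReal.ofReal (2 * (d : ℝ) / ((d : ℝ) - 4 / 3)) < q) :
    (IsLUB landauSet landauL ∧ 0.785746 ≤ landauL ∧ landauL < 0.785747) ∧
    (∀ k : ℕ, besselNorm d q k ≤ ENNReal.ofReal (besselBound d q k)) ∧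
    StrictAnti (fun k : ℕ => besselBound d q k) := by
  refine ⟨⟨isLUB_landauL, le_landauL, landauL_le_landauUpper.trans_lt (by norm_num [landauUpper])⟩,
    ?_⟩
  by_cases hq' : q = ∞
  · subst hq'
    simp only [besselBound, if_true]
    exact ⟨fun k => by simpa [besselBound] using besselNorm_top_le hd k,
      strictAnti_besselBoundTop hd⟩
  · obtain ⟨hp, hpd⟩ := lt_toReal_mul_of_lt hd hq' hq
    refine ⟨besselNorm_real_le hd hq' hp hpd, ?_⟩
    simp only [besselBound, if_neg hq']
    exact strictAnti_besselBoundReal hd hp hpd
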